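/- **Theorem (Localization).** Let $\kappa\ge 1$ and let $\mathbb J_\kappa$ be the graph made of $\kappa$ half lines joined at a common origin $0$; its other vertices are $h_r(x)$, $r\in\mathbb K_\kappa=\{0,\dots,\kappa-1\}$, $x\ge1$, where $h_r(x)$ is at distance $x$ from $0$ on the $r$-th half line. Let $\mathcal H$ have the orthonormal basis $|0,\epsilon_r\rangle$ ($r\in\mathbb K_\kappa$), $|h_r(x),l\rangle$ ($r\in\mathbb K_\kappa$, $x\ge 1$, $l\in\{Up,Down\}$). Let $C=\begin{bmatrix}a&b\\c&d\end{bmatrix}\in U(2)$ with $abcd\ne0$, written in the basis $(Up,Down)$, and let $G_\kappa$ be the Grover matrix, with diagonal entries $\frac2\kappa-1$ and off-diagonal entries $b_\kappa=\frac2\kappa$ (so $G_1=1$). The coin operator $F$ acts by $G_\kappa$ on the coin states at $0$ and by $C$ on the coin states at every other vertex; the shift is $S|0,\epsilon_r\rangle=|h_r(1),Down\rangle$, $S|h_r(x),Down\rangle=|h_r(x+1),Down\rangle$, $S|h_r(1),Up\rangle=|0,\epsilon_r\rangle$, $S|h_r(x),Up\rangle=|h_r(x-1),Up\rangle$ for $x\ge2$.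 The walk $W_{t,\kappa}$ has state $\Psi_t=(SF)^t\Psi_0$ with $\Psi_0=\sum_j\psi_j|0,\epsilon_j\rangle$, $\sum_j|\psi_j|^2=1$. Put $P(X_{t,r}=0)=|\langle 0,\epsilon_r|\Psi_t\rangle|^2$ and, for $x\ge1$, $P(X_{t,r}=x)=\sum_{l}|\langle h_r(x),l|\Psi_t\rangle|^2$. Let $\phi=\arg c$, $K_\pm=|1\pm c|^2$, $K_\times=(1-c)(1+\bar c)$, let $\delta_0(x)$ be $1$ if $x=0$ and $0$ otherwise, let square roots be principal, and put $$\Gamma_\pm(x)=\frac{b_\kappa^2|c|^2(\cos\phi\pm|c|)^2}{K_\pm^2}\Big\{\delta_0(x)+(1-\delta_0(x))\Big(\frac{|a|^2}{K_\pm}\Big)^{x-1}\Big(1+\frac{|a|^2}{K_\pm}\Big)\Big\},$$ $$\Gamma_\times(x,t)=\Big(\sqrt{K_\times/\overline{K_\times}}\Big)^{t+1}\frac{|c|^2(|c|^2-\cos^2\phi)}{K_\times^2}\Big\{-\delta_0(x)\sqrt{K_\times/\overline{K_\times}}+(1-\delta_0(x))\Big(\frac{|a|^2}{\sqrt{K_+K_-}}\Big)^{x-1}\Big(1-\frac{|a|^2}{\overline{K_\times}}\Big)\Big\},$$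 $$L_m(x)=\Gamma_-(x)\Big|\sum_j\psi_j\Big|^2,\qquad L_p^r(x)=\Gamma_+(x)\Big|\sum_j(\psi_j-\psi_r)\Big|^2,$$ $$L_c^r(x,t)=2b_\kappa^2\,\mathrm{Re}\Big[\Gamma_\times(x,t)\Big(\sum_j\overline{\psi_j}\Big)\Big(\sum_j(\psi_j-\psi_r)\Big)\Big].$$ Let $$A_r(x,t)=I_{[-1,|c|)}(\cos\phi)L_m(x)+I_{(-|c|,1]}(\cos\phi)L_p^r(x)+I_{(-|c|,|c|)}(\cos\phi)L_c^r(x,t).$$ Then for every $r\in\mathbb K_\kappa$ and every integer $x\ge0$, as $t\to\infty$, $$P(X_{t,r}=x)\sim\frac{1+(-1)^{t+x}}2\,A_r(x,t)$$ in the following sense: the difference of the two sides tends to $0$; both sides vanish when $t+x$ is odd; and the quotient of the two sides tends to $1$ along the $t$ with $t+x$ even, whenever $A_r(x,t)$ is bounded below by a positive constant for all large such $t$. Moreover each term decays exponentially in $x$ when its indicator is on. If $\cos\phi<|c|$, then $|a|^2/K_-<1$ and $L_m(x)=O((|a|^2/K_-)^x)$. If $\cos\phi>-|c|$, then $|a|^2/K_+<1$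 and $L_p^r(x)=O((|a|^2/K_+)^x)$. If $|\cos\phi|<|c|$, then $|a|^2/\sqrt{K_+K_-}<1$ and $L_c^r(x,t)=O((|a|^2/\sqrt{K_+K_-})^x)$ uniformly in $t$. -/

import Mathlib

open Filter Topology

namespace JoinedHalfLines

/-- The orthonormal basis of the state space of the walk on `κ` half lines joined at the origin `0`.
`origin r` is `|0, ε_r⟩`; `arm r n l` is `|h_r(n+1), l⟩`, a state at the vertex at distance `n + 1`
from the origin on the `r`-th half line, where `l = 0` is `Up` (towards the origin) and `l = 1` is
`Down` (away from the origin). -/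
inductive Ket (κ : ℕ) : Type
  | origin (r : Fin κ) : Ket κ
  | arm (r : Fin κ) (n : ℕ) (l : Fin 2) : Ket κ

/-- Superpositions of basis states. A walk started at the origin is at every time a superposition
of finitely many of them, so the span of the basis carries the whole evolution. -/
abbrev State (κ : ℕ) : Type := Ket κ →₀ ℂ

/-- The basis vector `|k⟩`. -/
noncomputable def ket {κ : ℕ} (k : Ket κ) : State κ := Finsupp.single k 1

/-- The Grover matrix `G_κ`: diagonal entries `a_κ = 2/κ - 1`, other entries `b_κ = 2/κ`. -/
noncomputable def grover (κ : ℕ) : Matrix (Fin κ) (Fin κ) ℂ :=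
  Matrix.of fun i j => if i = j then 2 / (κ : ℂ) - 1 else 2 / (κ : ℂ)

/-- The action of the shift operator on basis states. -/
def shiftKet {κ : ℕ} : Ket κ → Ket κ
  | .origin r => .arm r 0 1
  | .arm r 0 0 => .origin r
  | .arm r (n + 1) 0 => .arm r n 0
  | .arm r n 1 => .arm r (n + 1) 1

/-- The shift operator `S_J`. -/
noncomputable def shiftOp (κ : ℕ) : State κ →ₗ[ℂ] State κ :=
  Finsupp.linearCombination ℂ fun k => ket (shiftKet k)

/-- The action of the coin operator on basis states: `G_κ` at the origin, `C` elsewhere.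
The matrices act on column vectors, e.g. `C |Up⟩ = a |Up⟩ + c |Down⟩`. -/
noncomputable def coinKet {κ : ℕ} (C : Matrix (Fin 2) (Fin 2) ℂ) : Ket κ → State κ
  | .origin r => ∑ j : Fin κ, grover κ j r • ket (.origin j)
  | .arm r n l => ∑ m : Fin 2, C m l • ket (.arm r n m)

/-- The coin operator `F_J`. -/
noncomputable def coinOp (κ : ℕ) (C : Matrix (Fin 2) (Fin 2) ℂ) : State κ →ₗ[ℂ] State κ :=
  Finsupp.linearCombination ℂ (coinKet C)

/-- The evolution operator `U_J = S_J F_J`. -/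
noncomputable def evolution (κ : ℕ) (C : Matrix (Fin 2) (Fin 2) ℂ) : State κ →ₗ[ℂ] State κ :=
  shiftOp κ ∘ₗ coinOp κ C

/-- The initial state `∑ j, ψ_j |0, ε_j⟩`. -/
noncomputable def initialState {κ : ℕ} (ψ : Fin κ → ℂ) : State κ :=
  ∑ j : Fin κ, ψ j • ket (.origin j)

/-- The state of the walk at time `t`. -/
noncomputable def stateAt {κ : ℕ} (C : Matrix (Fin 2) (Fin 2) ℂ) (ψ : Fin κ → ℂ) (t : ℕ) :
    State κ :=
  (evolution κ C ^ t) (initialState ψ)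

/-- `P(X_{t,r} = x)`: for `x = 0` the squared modulus of the amplitude of `|0, ε_r⟩` at time `t`,
for `x ≥ 1` the probability of finding the walk at the vertex `h_r(x)` at time `t`. -/
noncomputable def prob {κ : ℕ} (C : Matrix (Fin 2) (Fin 2) ℂ) (ψ : Fin κ → ℂ) (r : Fin κ) (t : ℕ) :
    ℕ → ℝ
  | 0 => ‖stateAt C ψ t (.origin r)‖ ^ 2
  | n + 1 => ∑ l : Fin 2, ‖stateAt C ψ t (.arm r n l)‖ ^ 2

/-- `K_+ = |1 + c|²`. -/
noncomputable def Kplus (c : ℂ) : ℝ := ‖1 + c‖ ^ 2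

/-- `K_- = |1 - c|²`. -/
noncomputable def Kminus (c : ℂ) : ℝ := ‖1 - c‖ ^ 2

/-- `K_× = (1 - c)(1 + c̄)`. -/
noncomputable def Kcross (c : ℂ) : ℂ := (1 - c) * (1 + (starRingEnd ℂ) c)

/-- `cos φ` with `φ = arg c`. -/
noncomputable def cosPhase (c : ℂ) : ℝ := Real.cos (Complex.arg c)

/-- `√(K_× / K̄_×)`, with the principal square root. -/
noncomputable def phaseRoot (c : ℂ) : ℂ := (Kcross c / (starRingEnd ℂ) (Kcross c)) ^ (1 / 2 : ℂ)

/-- `b_κ = 2/κ`. -/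
noncomputable def bCoef (κ : ℕ) : ℝ := 2 / (κ : ℝ)

/-- `Γ_+(x)`. -/
noncomputable def gammaPlus (κ : ℕ) (a c : ℂ) (x : ℕ) : ℝ :=
  bCoef κ ^ 2 * ‖c‖ ^ 2 * (cosPhase c + ‖c‖) ^ 2 / Kplus c ^ 2 *
    (if x = 0 then 1 else (‖a‖ ^ 2 / Kplus c) ^ (x - 1) * (1 + ‖a‖ ^ 2 / Kplus c))

/-- `Γ_-(x)`. -/
noncomputable def gammaMinus (κ : ℕ) (a c : ℂ) (x : ℕ) : ℝ :=
  bCoef κ ^ 2 * ‖c‖ ^ 2 * (cosPhase c - ‖c‖) ^ 2 / Kminus c ^ 2 *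
    (if x = 0 then 1 else (‖a‖ ^ 2 / Kminus c) ^ (x - 1) * (1 + ‖a‖ ^ 2 / Kminus c))

/-- `Γ_×(x, t)`. -/
noncomputable def gammaCross (a c : ℂ) (x t : ℕ) : ℂ :=
  phaseRoot c ^ (t + 1) * (((‖c‖ ^ 2 * (‖c‖ ^ 2 - cosPhase c ^ 2) : ℝ) : ℂ) / Kcross c ^ 2) *
    (if x = 0 then -phaseRoot c
      else (((‖a‖ ^ 2 / Real.sqrt (Kplus c * Kminus c)) ^ (x - 1) : ℝ) : ℂ) *
        (1 - ((‖a‖ ^ 2 : ℝ) : ℂ) / (starRingEnd ℂ) (Kcross c)))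

/-- `L_m(x)`. -/
noncomputable def Lm {κ : ℕ} (a c : ℂ) (ψ : Fin κ → ℂ) (x : ℕ) : ℝ :=
  gammaMinus κ a c x * ‖∑ j, ψ j‖ ^ 2

/-- `L_p^r(x)`. -/
noncomputable def Lp {κ : ℕ} (a c : ℂ) (ψ : Fin κ → ℂ) (r : Fin κ) (x : ℕ) : ℝ :=
  gammaPlus κ a c x * ‖∑ j, (ψ j - ψ r)‖ ^ 2

/-- `L_c^r(x, t)`. -/
noncomputable def Lc {κ : ℕ} (a c : ℂ) (ψ : Fin κ → ℂ) (r : Fin κ) (x t : ℕ) : ℝ :=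
  2 * bCoef κ ^ 2 *
    (gammaCross a c x t * (∑ j, (starRingEnd ℂ) (ψ j)) * (∑ j, (ψ j - ψ r))).re

/-- The sum of the three terms, each with its indicator in `cos φ`. -/
noncomputable def envelope {κ : ℕ} (a c : ℂ) (ψ : Fin κ → ℂ) (r : Fin κ) (x t : ℕ) : ℝ :=
  (Set.Ico (-1) ‖c‖).indicator (fun _ => (1 : ℝ)) (cosPhase c) * Lm a c ψ x +
    (Set.Ioc (-‖c‖) 1).indicator (fun _ => (1 : ℝ)) (cosPhase c) * Lp a c ψ r x +
    (Set.Ioo (-‖c‖) ‖c‖).indicator (fun _ => (1 : ℝ)) (cosPhase c) * Lc a c ψ r x t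

/-- The asymptotic expression: the parity factor times the sum of the three terms. -/
noncomputable def asymptotic {κ : ℕ} (a c : ℂ) (ψ : Fin κ → ℂ) (r : Fin κ) (x t : ℕ) : ℝ :=
  (1 + (-1) ^ (t + x)) / 2 * envelope a c ψ r x t

end JoinedHalfLines

open JoinedHalfLines

/-! The Grover matrix is twice the projection onto constant vectors minus the identity, so it acts
as `1` on constants and as `-1` on vectors of mean zero. By linearity, the state on the `r`-th half
line is `mean ψ` times a walk on a single half line with reflecting coin `e = 1`, plus `ψ r - mean
ψ` times the walk with `e = -1` (`stateAt_eq`). What remains is the long-time behaviour of the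
scalar walk `IsWalk` for `e = ±1`.

That walk has a formal stationary solution of shape `q ^ n * μ ^ t` on one parity class, with `q =
decayRatio` and `|μ| = 1`, `μ = eigenPhase`. To see that the walk approaches a multiple of it, write
the generating function at the origin as `1 / (1 - e g)`, where `g` is a root of a quadratic whose
discriminant is a quartic with all zeros on the unit circle. Since `√(1 - X)` has absolutely
summable coefficients, so does `g` (`exists_firstReturn`); rationalising `1 - e g` then shows that
multiplication by `1 - μ² X²` makes the generating function absolutely summable (`exists_isWalk`).
Hence the amplitude at the origin behaves like `A μ ^ t` along even times, and the recurrences carry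
this to every site (`IsWalk.tendsto_zero`).

The constant `A` comes from two conservation laws (`limitAmp_eq_of_tendsto`). If `|q| < 1`, the
pairing with the stationary solution is multiplied by `μ` at each step, and dominated convergence
gives `A = 1 - |q|²`. If `|q| ≥ 1`, a nonzero `A` would give the limit infinite energy. So `A = max
0 (1 - |q|²)`, and the sign of `1 - |q|²` is what the indicators in `cos φ` record. Expanding the
squared modulus of the two superposed limits gives `Lm`, `Lp` and the interference term `Lc`, whose
dependence on `t` is the relative phase of the two eigenvalues. -/

namespace JoinedHalfLines

open ComplexConjugate

/-! ### Absolutely summable power series and the square root of `1 - X`. -/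

open PowerSeries in
/-- Power series with absolutely summable coefficients. -/
def AbsSummable (f : PowerSeries ℂ) : Prop := Summable fun n => ‖coeff n f‖

namespace AbsSummable

open PowerSeries

theorem add {f g : PowerSeries ℂ} (hf : AbsSummable f) (hg : AbsSummable g) :
    AbsSummable (f + g) :=
  Summable.of_nonneg_of_le (fun _ => norm_nonneg _)
    (fun n => by rw [map_add]; exact norm_add_le _ _) (Summable.add hf hg)

theorem mul {f g : PowerSeries ℂ} (hf : AbsSummable f) (hg : AbsSummable g) :
    AbsSummable (f * g) := by
  have := summable_norm_sum_mul_antidiagonal_of_summable_norm hf hg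
  simpa only [AbsSummable, coeff_mul] using this

theorem constant (z : ℂ) : AbsSummable (C z) := by
  refine summable_of_ne_finset_zero (s := {0}) fun n hn => ?_
  rw [coeff_C, if_neg (by simpa using hn), norm_zero]

theorem X : AbsSummable (X : PowerSeries ℂ) := by
  refine summable_of_ne_finset_zero (s := {1}) fun n hn => ?_
  rw [coeff_X, if_neg (by simpa using hn), norm_zero]

theorem neg {f : PowerSeries ℂ} (hf : AbsSummable f) : AbsSummable (-f) := by
  simpa only [AbsSummable, map_neg, norm_neg] using hf

theorem sub {f g : PowerSeries ℂ} (hf : AbsSummable f) (hg : AbsSummable g) :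
    AbsSummable (f - g) := by
  rw [sub_eq_add_neg]; exact hf.add hg.neg

theorem rescale {f : PowerSeries ℂ} (hf : AbsSummable f) {z : ℂ} (hz : ‖z‖ ≤ 1) :
    AbsSummable (PowerSeries.rescale z f) := by
  refine Summable.of_nonneg_of_le (fun _ => norm_nonneg _) (fun n => ?_) hf
  rw [coeff_rescale, norm_mul, norm_pow]
  exact mul_le_of_le_one_left (norm_nonneg _) (pow_le_one₀ (norm_nonneg _) hz)

end AbsSummable

/-- The terms telescope: each is twice the decrement of `centralBinom n / 4 ^ n`, which starts at
`1` and stays nonnegative, so the partial sums are at most `2`. -/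
theorem summable_catalan_div_four_pow : Summable fun n : ℕ => (catalan n : ℝ) / 4 ^ n := by
  have key : ∀ n : ℕ, (catalan n : ℝ) / 4 ^ n =
      2 * ((n.centralBinom : ℝ) / 4 ^ n - ((n + 1).centralBinom : ℝ) / 4 ^ (n + 1)) := by
    intro n
    have h1 : ((n : ℝ) + 1) * catalan n = n.centralBinom := by
      exact_mod_cast succ_mul_catalan_eq_centralBinom n
    have h2 : ((n : ℝ) + 1) * (n + 1).centralBinom = 2 * (2 * n + 1) * n.centralBinom := by
      exact_mod_cast Nat.succ_mul_centralBinom_succ n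
    have h3 : (n : ℝ) + 1 ≠ 0 := by positivity
    have h4 : ((n + 1).centralBinom : ℝ) = 2 * (2 * n + 1) * catalan n := by
      apply mul_left_cancel₀ h3
      rw [h2, ← h1]; ring
    rw [← h1, h4, pow_succ]
    field_simp
    ring
  refine summable_of_sum_range_le (c := 2) (fun n => by positivity) fun n => ?_
  rw [Finset.sum_congr rfl fun i _ => key i, ← Finset.mul_sum,
    Finset.sum_range_sub' (fun n : ℕ => (n.centralBinom : ℝ) / 4 ^ n)]
  have : (0 : ℝ) ≤ (n.centralBinom : ℝ) / 4 ^ n := by positivity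
  simp only [Nat.centralBinom_zero, pow_zero]
  norm_num
  linarith

-- The Catalan series `K` satisfies `K = 1 + X K²`, so completing the square shows that `1 - (X / 2)
-- K(X / 4)` squares to `1 - X`. Its coefficients are controlled up to and on the unit circle by the
-- sum of `catalan n / 4 ^ n`.
open PowerSeries in
theorem exists_absSummable_sqrt_one_sub_X :
    ∃ h : PowerSeries ℂ, AbsSummable h ∧ h ^ 2 = 1 - X ∧ constantCoeff h = 1 := by
  set K : PowerSeries ℂ := PowerSeries.map (Nat.castRingHom ℂ) catalanSeries with hK
  have hKeq : K ^ 2 * X + 1 = K := by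
    have := congrArg (PowerSeries.map (Nat.castRingHom ℂ)) catalanSeries_sq_mul_X_add_one
    simpa [hK] using this
  set R : PowerSeries ℂ := rescale (1 / 4 : ℂ) K with hR
  have hReq : R ^ 2 * (C (1 / 4 : ℂ) * X) + 1 = R := by
    have := congrArg (rescale (1 / 4 : ℂ)) hKeq
    simpa [hR, rescale_X] using this
  have hC : (C (1 / 2 : ℂ)) ^ 2 = C (1 / 4 : ℂ) := by rw [← map_pow]; norm_num
  have hC2 : (C (1 / 2 : ℂ)) * 2 = 1 := by
    have : (2 : PowerSeries ℂ) = C (2 : ℂ) := (map_ofNat C 2).symm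
    rw [this, ← map_mul]; norm_num
  have hRs : AbsSummable R := by
    refine summable_catalan_div_four_pow.congr fun n => ?_
    simp [hR, hK, div_eq_inv_mul]
  refine ⟨1 - C (1 / 2 : ℂ) * X * R, ?_, ?_, by simp⟩
  · have h1 : AbsSummable (1 : PowerSeries ℂ) := by
      simpa using AbsSummable.constant 1
    exact h1.sub (((AbsSummable.constant _).mul AbsSummable.X).mul hRs)
  · linear_combination (X ^ 2 * R ^ 2) * hC - X * R * hC2 + X * hReq

/-! ### The walk on one half line. -/

/-- A solution of the evolution equations of the walk on one half line with reflecting coin `e` at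
the origin. `U t 0` is the amplitude at the origin, `U t (n + 1)` and `V t n` are the amplitudes of
`Up` and `Down` at distance `n + 1`. -/
structure IsWalk (a b c d e : ℂ) (U V : ℕ → ℕ → ℂ) : Prop where
  up : ∀ t n, U (t + 1) n = a * U t (n + 1) + b * V t n
  turn : ∀ t, V (t + 1) 0 = e * U t 0
  down : ∀ t n, V (t + 1) (n + 1) = c * U t (n + 1) + d * V t n

namespace IsWalk

variable {a b c d e : ℂ} {U V U' V' : ℕ → ℕ → ℂ}

theorem ext_of_zero (h : IsWalk a b c d e U V) (h' : IsWalk a b c d e U' V')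
    (hU : U 0 = U' 0) (hV : V 0 = V' 0) : U = U' ∧ V = V' := by
  have key : ∀ t, U t = U' t ∧ V t = V' t := by
    intro t
    induction t with
    | zero => exact ⟨hU, hV⟩
    | succ t ih =>
      refine ⟨?_, ?_⟩
      · funext n; rw [h.up, h'.up, ih.1, ih.2]
      · funext n
        cases n with
        | zero => rw [h.turn, h'.turn, ih.1]
        | succ n => rw [h.down, h'.down, ih.1, ih.2]
  exact ⟨funext fun t => (key t).1, funext fun t => (key t).2⟩

theorem linear_combination (h : IsWalk a b c d e U V) (h' : IsWalk a b c d e U' V') (z w : ℂ) :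
    IsWalk a b c d e (fun t n => z * U t n + w * U' t n) (fun t n => z * V t n + w * V' t n) where
  up t n := by simp only [h.up, h'.up]; ring
  turn t := by simp only [h.turn, h'.turn]; ring
  down t n := by simp only [h.down, h'.down]; ring

/-- Because `a ≠ 0`, the `up` equation can be solved for the amplitude one site further out, so
decay at the origin propagates outwards. -/
theorem tendsto_zero (h : IsWalk a b c d e U V) (ha : a ≠ 0)
    (h0 : Tendsto (fun t => U t 0) atTop (𝓝 0)) (n : ℕ) :
    Tendsto (fun t => U t n) atTop (𝓝 0) ∧ Tendsto (fun t => V t n) atTop (𝓝 0) := by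
  have up : ∀ n, Tendsto (fun t => U t n) atTop (𝓝 0) → Tendsto (fun t => V t n) atTop (𝓝 0) →
      Tendsto (fun t => U t (n + 1)) atTop (𝓝 0) := by
    intro n hU hV
    have : (fun t => U t (n + 1)) = fun t => a⁻¹ * (U (t + 1) n - b * V t n) := by
      funext t
      rw [h.up]; field_simp; ring
    rw [this]
    simpa using (((tendsto_add_atTop_iff_nat 1).2 hU).sub (hV.const_mul b)).const_mul a⁻¹
  induction n with
  | zero =>
    refine ⟨h0, (tendsto_add_atTop_iff_nat 1).1 ?_⟩
    simpa only [h.turn, mul_zero] using h0.const_mul e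
  | succ n ih =>
    have hU := up n ih.1 ih.2
    refine ⟨hU, (tendsto_add_atTop_iff_nat 1).1 ?_⟩
    simpa only [h.down, mul_zero, add_zero] using (hU.const_mul c).add (ih.2.const_mul d)

theorem parity (h : IsWalk a b c d e U V) (hU : ∀ n, Odd n → U 0 n = 0) (hV : ∀ n, V 0 n = 0)
    (t : ℕ) : ∀ n, (Odd (t + n) → U t n = 0) ∧ (Even (t + n) → V t n = 0) := by
  induction t with
  | zero => exact fun n => ⟨fun hn => hU n (by simpa using hn), fun _ => hV n⟩
  | succ t ih =>
    intro n
    refine ⟨fun hn => ?_, fun hn => ?_⟩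
    · rw [h.up, (ih (n + 1)).1 (by convert hn using 1; ring),
        (ih n).2 (by rw [Nat.odd_iff] at hn; rw [Nat.even_iff]; omega)]
      ring
    · cases n with
      | zero => rw [h.turn, (ih 0).1 (by rw [Nat.even_iff] at hn; rw [Nat.odd_iff]; omega)]; ring
      | succ n =>
        rw [h.down, (ih (n + 1)).1 (by rw [Nat.even_iff] at hn; rw [Nat.odd_iff]; omega),
          (ih n).2 (by rw [Nat.even_iff] at hn ⊢; omega)]
        ring

end IsWalk

/-! ### Generating functions and first returns. -/

open PowerSeries in
/-- A solution `g` of the equation satisfied by the generating function of the first return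
amplitudes yields the walk started at the origin. -/
theorem exists_isWalk_of_firstReturn {a b c d e : ℂ} {g : PowerSeries ℂ}
    (hg0 : constantCoeff g = 0)
    (hg : C c * g ^ 2 - (1 - C (a * d - b * c) * X ^ 2) * g + C b * X ^ 2 = 0) :
    ∃ U V : ℕ → ℕ → ℂ, IsWalk a b c d e U V ∧ (U 0 = fun n => if n = 0 then 1 else 0) ∧ V 0 = 0 ∧
      ∀ t, U t 0 = coeff t (1 - C e * g)⁻¹ := by
  set A := C a with hA
  set D := C d with hD
  set B := C b with hB
  set K := C c with hK
  set E := C e with hE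
  have hdet : C (a * d - b * c) = A * D - B * K := by simp [hA, hD, hB, hK]
  rw [hdet] at hg
  have hO : (1 - E * g)⁻¹ * (1 - E * g) = 1 :=
    PowerSeries.inv_mul_cancel _ (by simp [hg0])
  have hL : (1 - K * g)⁻¹ * (1 - K * g) = 1 :=
    PowerSeries.inv_mul_cancel _ (by simp [hg0])
  set O := (1 - E * g)⁻¹
  set I := (1 - K * g)⁻¹
  -- Transfer factors between generating functions. `s` turns `Down` into `Up` at the same vertex:
  -- leave outwards with `d`, return with `g`, and repeat through the reflections `c`, summed by
  -- `I`. `w` turns `Down` at a vertex into `Up` one site closer to the origin, and `ρ` moves `Down`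
  -- one site outwards. The quadratic for `g` says `X * w = g`: go out one step, then come back.
  set s := D * g * I with hs
  set w := X * (A * s + B) with hw
  set ρ := X * (K * s + D) with hρ
  have hXw : X * w = g := by
    have : X * w = X ^ 2 * (A * s + B) := by rw [hw]; ring
    rw [this, hs]
    linear_combination (-X ^ 2 * B) * hL + I * hg + g * hL
  have hsw : s = w * ρ := by
    have : w * ρ = g * (K * s + D) := by rw [hρ, ← hXw]; ring
    rw [this, hs]
    linear_combination (D * g) * hL
  refine ⟨fun t n => coeff t (if n = 0 then O else s * (ρ ^ (n - 1) * (E * X * O))),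
    fun t n => coeff t (ρ ^ n * (E * X * O)), ⟨?_, ?_, ?_⟩, ?_, ?_, ?_⟩
  · intro t n
    have : (if n = 0 then O else s * (ρ ^ (n - 1) * (E * X * O))) = C (if n = 0 then 1 else 0) +
        X * (A * (s * (ρ ^ n * (E * X * O))) + B * (ρ ^ n * (E * X * O))) := by
      cases n with
      | zero =>
        simp only [if_true, pow_zero, map_one]
        have : X * (A * (s * (1 * (E * X * O))) + B * (1 * (E * X * O))) = E * (X * w) * O := by
          rw [hw]; ring
        rw [this, hXw]
        linear_combination hO
      | succ n =>
        simp only [Nat.succ_ne_zero, if_false, map_zero, zero_add, Nat.add_sub_cancel]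
        have : X * (A * (s * (ρ ^ (n + 1) * (E * X * O))) + B * (ρ ^ (n + 1) * (E * X * O))) =
            w * ρ * (ρ ^ n * (E * X * O)) := by
          rw [hw]; ring
        rw [this, ← hsw]
    rw [this]
    simp only [Nat.succ_ne_zero, if_false, map_add, coeff_succ_C, zero_add, coeff_succ_X_mul,
      Nat.add_sub_cancel, hA, hB, coeff_C_mul]
  · intro t
    have : ρ ^ 0 * (E * X * O) = X * (E * O) := by ring
    rw [this, coeff_succ_X_mul, hE, coeff_C_mul]
    simp
  · intro t n
    have : ρ ^ (n + 1) * (E * X * O) =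
        X * (K * (s * (ρ ^ n * (E * X * O))) + D * (ρ ^ n * (E * X * O))) := by
      rw [pow_succ]; nth_rw 2 [hρ]; ring
    rw [this, coeff_succ_X_mul]
    simp [hK, hD]
  · funext n
    cases n with
    | zero => simp [O, hg0]
    | succ n => simp
  · funext n
    simp
  · intro t
    simp

/-! ### Eigenvalue relations and the singularity of the generating function. -/

/-- The ratio of consecutive components of the stationary solution. -/
noncomputable def decayRatio (a c δ e : ℂ) : ℂ := conj a * δ / ‖1 - e * c‖

/-- The eigenvalue of the stationary solution. -/
noncomputable def eigenPhase (c δ e : ℂ) : ℂ := δ * (1 - e * conj c) / ‖1 - e * c‖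

section Parameters

variable {a c δ e : ℂ}

theorem conj_sign (he : e = 1 ∨ e = -1) : conj e = e := by
  rcases he with rfl | rfl <;> simp

theorem sign_mul_self (he : e = 1 ∨ e = -1) : e * e = 1 := by
  rcases he with rfl | rfl <;> simp

theorem norm_lt_one (ha : a ≠ 0) (hac : a * conj a + c * conj c = 1) : ‖c‖ < 1 := by
  have h : ‖a‖ ^ 2 + ‖c‖ ^ 2 = 1 := by
    rw [Complex.mul_conj', Complex.mul_conj'] at hac
    exact_mod_cast hac
  have := norm_pos_iff.2 ha
  nlinarith [norm_nonneg c]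

theorem one_sub_sign_mul_ne_zero (ha : a ≠ 0) (hac : a * conj a + c * conj c = 1)
    (he : e = 1 ∨ e = -1) : 1 - e * c ≠ 0 := by
  intro h
  have h1 : e * c = 1 := (sub_eq_zero.1 h).symm
  have h2 : ‖e * c‖ = ‖c‖ := by rcases he with rfl | rfl <;> simp
  rw [h1, norm_one] at h2
  exact absurd (norm_lt_one ha hac) (by rw [← h2]; exact lt_irrefl _)

theorem one_sub_mul_conj (he : e = 1 ∨ e = -1) :
    (1 - e * c) * (1 - e * conj c) = (‖1 - e * c‖ : ℂ) ^ 2 := by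
  rw [← Complex.mul_conj', map_sub, map_mul, map_one, conj_sign he]

theorem eigenPhase_mul_conj (hne : 1 - e * c ≠ 0) (hδ : δ * conj δ = 1) (he : e = 1 ∨ e = -1) :
    eigenPhase c δ e * conj (eigenPhase c δ e) = 1 := by
  have hN : (‖1 - e * c‖ : ℂ) ≠ 0 := by exact_mod_cast norm_ne_zero_iff.2 hne
  simp only [eigenPhase, map_div₀, map_mul, map_sub, map_one, conj_sign he, Complex.conj_conj,
    Complex.conj_ofReal]
  field_simp
  linear_combination (1 - e * conj c) * (1 - e * c) * hδ + one_sub_mul_conj (c := c) he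

theorem eigenPhase_sq (hne : 1 - e * c ≠ 0) (he : e = 1 ∨ e = -1) :
    eigenPhase c δ e ^ 2 * (1 - e * c) = δ ^ 2 * (1 - e * conj c) := by
  have hN : (‖1 - e * c‖ : ℂ) ≠ 0 := by exact_mod_cast norm_ne_zero_iff.2 hne
  simp only [eigenPhase]
  field_simp
  linear_combination δ ^ 2 * (1 - e * conj c) * one_sub_mul_conj (c := c) he

/-- With `eigen_down`, this is what remains of the recurrences for the ansatz `U = q ^ n * μ ^ t`,
`V = e * conj μ * q ^ n * μ ^ t` after cancelling powers. -/
theorem eigen_up (hne : 1 - e * c ≠ 0) (hac : a * conj a + c * conj c = 1)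
    (hδ : δ * conj δ = 1) (he : e = 1 ∨ e = -1) :
    a * decayRatio a c δ e + -(δ ^ 2 * conj c) * (e * conj (eigenPhase c δ e)) =
      eigenPhase c δ e := by
  have hN : (‖1 - e * c‖ : ℂ) ≠ 0 := by exact_mod_cast norm_ne_zero_iff.2 hne
  simp only [decayRatio, eigenPhase, map_div₀, map_mul, map_sub, map_one, conj_sign he,
    Complex.conj_conj, Complex.conj_ofReal]
  field_simp
  linear_combination δ * hac - δ * conj c * (e - e * e * c) * hδ + δ * conj c * c *
    sign_mul_self he

theorem eigen_down (hne : 1 - e * c ≠ 0) (hδ : δ * conj δ = 1) (he : e = 1 ∨ e = -1) :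
    c * decayRatio a c δ e + δ ^ 2 * conj a * (e * conj (eigenPhase c δ e)) =
      e * decayRatio a c δ e := by
  have hN : (‖1 - e * c‖ : ℂ) ≠ 0 := by exact_mod_cast norm_ne_zero_iff.2 hne
  simp only [decayRatio, eigenPhase, map_div₀, map_mul, map_sub, map_one, conj_sign he,
    Complex.conj_conj, Complex.conj_ofReal]
  generalize (‖1 - e * c‖ : ℂ) = N at hN
  field_simp
  linear_combination δ * conj a * (e - e * e * c) * hδ - δ * conj a * c * sign_mul_self he

/-- The adjoint relations: one evolution step multiplies by `μ` the functional with weights `conj q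
^ n` on `U` and `e * μ * conj q ^ n` on `V`. -/
theorem eigen_up_adjoint (hne : 1 - e * c ≠ 0) (hδ : δ * conj δ = 1) (he : e = 1 ∨ e = -1) :
    a + e * eigenPhase c δ e * conj (decayRatio a c δ e) * c =
      eigenPhase c δ e * conj (decayRatio a c δ e) := by
  have hN : (‖1 - e * c‖ : ℂ) ≠ 0 := by exact_mod_cast norm_ne_zero_iff.2 hne
  simp only [decayRatio, eigenPhase, map_div₀, map_mul, Complex.conj_conj, Complex.conj_ofReal]
  field_simp
  linear_combination (-a) * one_sub_mul_conj (c := c) he -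
    a * (1 - e * conj c) * (1 - e * c) * hδ

theorem eigen_down_adjoint (hne : 1 - e * c ≠ 0) (hac : a * conj a + c * conj c = 1)
    (hδ : δ * conj δ = 1) (he : e = 1 ∨ e = -1) :
    -(δ ^ 2 * conj c) + e * eigenPhase c δ e * conj (decayRatio a c δ e) * (δ ^ 2 * conj a) =
      e * eigenPhase c δ e ^ 2 := by
  have hN : (‖1 - e * c‖ : ℂ) ≠ 0 := by exact_mod_cast norm_ne_zero_iff.2 hne
  simp only [decayRatio, eigenPhase, map_div₀, map_mul, Complex.conj_conj, Complex.conj_ofReal]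
  field_simp
  linear_combination δ ^ 2 * conj c * one_sub_mul_conj (c := c) he +
    e * δ ^ 2 * (1 - e * conj c) * a * conj a * hδ + e * δ ^ 2 * (1 - e * conj c) * hac +
    δ ^ 2 * (1 - e * conj c) * conj c * sign_mul_self he

theorem norm_decayRatio_sq (hδ : δ * conj δ = 1) :
    ‖decayRatio a c δ e‖ ^ 2 = ‖a‖ ^ 2 / ‖1 - e * c‖ ^ 2 := by
  have h : ‖δ‖ ^ 2 = 1 := by
    rw [Complex.mul_conj'] at hδ
    exact_mod_cast hδ
  simp only [decayRatio, norm_div, norm_mul, Complex.norm_conj, Complex.norm_real, norm_norm,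
    div_pow, mul_pow, h, mul_one]

-- The discriminant of the quadratic factors as `(1 - β² X²)(1 - γ² X²)` with `β`, `γ` equal to `δ
-- (|a| ± i |c|)`, both unimodular since `|a|² + |c|² = 1`. Rescaling `√(1 - X)` by `±β` and `±γ`
-- keeps absolute summability, and the product is a square root of the discriminant.
open PowerSeries in
theorem exists_firstReturn (hc : c ≠ 0) (hac : a * conj a + c * conj c = 1)
    (hδ : δ * conj δ = 1) :
    ∃ g : PowerSeries ℂ, AbsSummable g ∧ constantCoeff g = 0 ∧
      C c * g ^ 2 - (1 - C (δ ^ 2) * X ^ 2) * g + C (-(δ ^ 2 * conj c)) * X ^ 2 = 0 := by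
  obtain ⟨h, hs, hsq, h0⟩ := exists_absSummable_sqrt_one_sub_X
  rw [Complex.mul_conj'] at hac
  rw [Complex.mul_conj'] at hδ
  have hδn : ‖δ‖ = 1 := by
    have : ‖δ‖ ^ 2 = 1 := by exact_mod_cast hδ
    exact (pow_eq_one_iff_of_nonneg (norm_nonneg _) two_ne_zero).1 this
  have hroot : ∀ s : ℝ, s ^ 2 = ‖c‖ ^ 2 → ‖δ * (‖a‖ + s * Complex.I)‖ ≤ 1 := by
    intro s hs
    have h1 : ‖(‖a‖ + s * Complex.I : ℂ)‖ ^ 2 = 1 := by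
      rw [Complex.sq_norm, Complex.normSq_add_mul_I, hs]
      rw [Complex.mul_conj'] at hac
      exact_mod_cast hac
    rw [norm_mul, hδn, one_mul]
    exact ((pow_eq_one_iff_of_nonneg (norm_nonneg _) two_ne_zero).1 h1).le
  set β := δ * (‖a‖ + ‖c‖ * Complex.I) with hβ
  set γ := δ * (‖a‖ + (-‖c‖ : ℝ) * Complex.I) with hγ
  have hβ1 : ‖β‖ ≤ 1 := hroot _ rfl
  have hγ1 : ‖γ‖ ≤ 1 := hroot _ (by ring)
  have hsc : ∀ z : ℂ, rescale z h ^ 2 = 1 - C z * X := by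
    intro z
    rw [← map_pow, hsq, map_sub, map_one, rescale_X]
  set H := rescale β h * rescale (-β) h * (rescale γ h * rescale (-γ) h) with hH
  have hHs : AbsSummable H :=
    ((hs.rescale hβ1).mul (hs.rescale (by simpa using hβ1))).mul
      ((hs.rescale hγ1).mul (hs.rescale (by simpa using hγ1)))
  have hsum : β ^ 2 + γ ^ 2 = δ ^ 2 * (2 - 4 * (c * conj c)) := by
    rw [Complex.mul_conj'] at hac ⊢
    rw [hβ, hγ]
    push_cast
    linear_combination 2 * δ ^ 2 * hac + 2 * δ ^ 2 * (‖c‖ : ℂ) ^ 2 * Complex.I_sq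
  have hprod : β ^ 2 * γ ^ 2 = δ ^ 4 := by
    have : β * γ = δ ^ 2 := by
      rw [Complex.mul_conj'] at hac
      rw [hβ, hγ]
      push_cast
      linear_combination δ ^ 2 * hac - δ ^ 2 * (‖c‖ : ℂ) ^ 2 * Complex.I_sq
    rw [← mul_pow, this]; ring
  have hHsq : H ^ 2 = (1 - C (δ ^ 2) * X ^ 2) ^ 2 - 4 * C (-(δ ^ 2 * conj c)) * C c * X ^ 2 := by
    have e1 := congrArg (C (R := ℂ)) hsum
    have e2 := congrArg (C (R := ℂ)) hprod
    rw [hH, mul_pow, mul_pow, mul_pow, hsc, hsc, hsc, hsc]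
    simp only [map_add, map_mul, map_neg, map_pow, map_sub, map_ofNat] at e1 e2 ⊢
    linear_combination (-X ^ 2) * e1 + X ^ 4 * e2
  have h2 : 2 * C c * C (1 / (2 * c)) = 1 := by
    rw [← map_ofNat (C (R := ℂ)) 2, ← map_mul, ← map_mul, ← map_one (C (R := ℂ))]
    congr 1
    field_simp
  have hP : AbsSummable (1 - C (δ ^ 2) * X ^ 2 - H) := by
    have h1 : AbsSummable (1 : PowerSeries ℂ) := by simpa using AbsSummable.constant 1
    rw [pow_two X]
    exact (h1.sub ((AbsSummable.constant _).mul (AbsSummable.X.mul AbsSummable.X))).sub hHs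
  have hH0 : constantCoeff H = 1 := by
    have : ∀ z, constantCoeff (rescale z h) = 1 := by
      intro z
      rw [← coeff_zero_eq_constantCoeff_apply, coeff_rescale, coeff_zero_eq_constantCoeff_apply,
        h0]
      simp
    simp [hH, this]
  -- Of the two roots, the one with `-H` has vanishing constant term, since `H` has constant term
  -- `1`.
  refine ⟨C (1 / (2 * c)) * (1 - C (δ ^ 2) * X ^ 2 - H), (AbsSummable.constant _).mul hP, ?_, ?_⟩
  · simp [hH0]
  · set P := 1 - C (δ ^ 2) * X ^ 2
    set L := C (1 / (2 * c))
    set B := C (-(δ ^ 2 * conj c))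
    linear_combination C c * L ^ 2 * hHsq +
      (L * P ^ 2 - P * H * L - B * X ^ 2 * (2 * C c * L + 1)) * h2

-- The denominator `1 - e g` is rationalised: its product with the conjugate factor is a polynomial
-- of degree two, a constant times `1 - μ² X²`. Thus `(1 - μ² X²) / (1 - e g)` is affine in `g` and
-- inherits its summability; its coefficients are the increments in the conclusion.
open PowerSeries in
theorem exists_isWalk (ha : a ≠ 0) (hc : c ≠ 0) (hac : a * conj a + c * conj c = 1)
    (hδ : δ * conj δ = 1) (he : e = 1 ∨ e = -1) :
    ∃ U V : ℕ → ℕ → ℂ, IsWalk a (-(δ ^ 2 * conj c)) c (δ ^ 2 * conj a) e U V ∧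
      (U 0 = fun n => if n = 0 then 1 else 0) ∧ V 0 = 0 ∧
      Summable fun t => ‖U (t + 2) 0 - eigenPhase c δ e ^ 2 * U t 0‖ := by
  obtain ⟨g, hgs, hg0, hg⟩ := exists_firstReturn hc hac hδ
  have hdet : a * (δ ^ 2 * conj a) - -(δ ^ 2 * conj c) * c = δ ^ 2 := by
    linear_combination δ ^ 2 * hac
  obtain ⟨U, V, hw, hU, hV, hco⟩ := exists_isWalk_of_firstReturn (a := a)
    (b := -(δ ^ 2 * conj c)) (c := c) (d := δ ^ 2 * conj a) (e := e) hg0 (by rw [hdet]; exact hg)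
  refine ⟨U, V, hw, hU, hV, ?_⟩
  have hne := one_sub_sign_mul_ne_zero ha hac he
  have hee := sign_mul_self he
  have hce : c - e ≠ 0 := by
    have : c - e = -e * (1 - e * c) := by linear_combination (-c) * hee
    rw [this]
    refine mul_ne_zero ?_ hne
    rcases he with rfl | rfl <;> simp
  have hO : (1 - C e * g)⁻¹ * (1 - C e * g) = 1 :=
    PowerSeries.inv_mul_cancel _ (by simp [hg0])
  set O := (1 - C e * g)⁻¹
  have hscalar : e * δ ^ 2 + -(δ ^ 2 * conj c) = -((c - e) * eigenPhase c δ e ^ 2) := by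
    linear_combination (-e) * eigenPhase_sq (δ := δ) hne he +
      (δ ^ 2 * conj c - c * eigenPhase c δ e ^ 2) * hee
  have hN : (1 - C (eigenPhase c δ e ^ 2) * X ^ 2) * O = C (1 / (c - e)) *
      (C c - C e * (1 - C (δ ^ 2) * X ^ 2) + C e * C c * g) := by
    have h1 : C (1 / (c - e)) * (C c - C e) = 1 := by
      rw [← map_sub, ← map_mul, ← map_one (C (R := ℂ))]
      congr 1
      field_simp
    have h2 := congrArg (C (R := ℂ)) hscalar
    have h3 := congrArg (C (R := ℂ)) hee
    simp only [map_add, map_mul, map_neg, map_pow, map_sub, map_one] at h2 h3 hg ⊢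
    -- If `g'` is the other root of the quadratic, then the first factor on the right is `c (1 - e
    -- g')`, so the product is `c` times the norm of `1 - e g`.
    have h4 : (C c - C e) * (1 - C (eigenPhase c δ e) ^ 2 * X ^ 2) =
        (C c - C e * (1 - C δ ^ 2 * X ^ 2) + C e * C c * g) * (1 - C e * g) := by
      linear_combination (-X ^ 2) * h2 + hg +
        (C c * g ^ 2 - (1 - C δ ^ 2 * X ^ 2) * g) * h3
    set Lc := C (1 / (c - e))
    linear_combination (-(1 - C (eigenPhase c δ e) ^ 2 * X ^ 2) * O) * h1 + Lc * O * h4 +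
      Lc * (C c - C e * (1 - C δ ^ 2 * X ^ 2) + C e * C c * g) * hO
  have hs : AbsSummable ((1 - C (eigenPhase c δ e ^ 2) * X ^ 2) * O) := by
    have h1 : AbsSummable (1 : PowerSeries ℂ) := by simpa using AbsSummable.constant 1
    rw [hN, pow_two X]
    have h2 := h1.sub ((AbsSummable.constant (δ ^ 2)).mul (AbsSummable.X.mul AbsSummable.X))
    exact (AbsSummable.constant _).mul ((((AbsSummable.constant _)).sub
      ((AbsSummable.constant _).mul h2)).add
      (((AbsSummable.constant _).mul (AbsSummable.constant _)).mul hgs))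
  refine ((summable_nat_add_iff 2).2 hs).congr fun t => ?_
  rw [hco, hco, sub_mul, one_mul, map_sub, mul_assoc, coeff_C_mul, coeff_X_pow_mul]

end Parameters

/-! ### The stationary solution and convergence at the origin. -/

/-- The indicator of the even numbers. -/
noncomputable def evenInd (n : ℕ) : ℂ := if Even n then 1 else 0

theorem evenInd_add_two (n : ℕ) : evenInd (n + 2) = evenInd n := by
  simp only [evenInd, Nat.even_add, even_two, iff_true]

theorem evenInd_add_succ (n : ℕ) : evenInd n + evenInd (n + 1) = 1 := by
  simp only [evenInd, Nat.even_add_one]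
  split_ifs <;> simp

theorem norm_evenInd_le (n : ℕ) : ‖evenInd n‖ ≤ 1 := by
  simp only [evenInd]; split_ifs <;> simp

/-- The limit of the modulus of the amplitude at the origin along even times. -/
noncomputable def limitAmp (a c e : ℂ) : ℝ := max 0 (1 - ‖a‖ ^ 2 / ‖1 - e * c‖ ^ 2)

section

variable {a c δ e : ℂ}

/-- The parity factor is compatible with the recurrences because every step changes the parity of
the site; equivalently, the eigenvalues `μ` and `-μ` are superposed. -/
theorem isWalk_stationary (hne : 1 - e * c ≠ 0) (hac : a * conj a + c * conj c = 1)
    (hδ : δ * conj δ = 1) (he : e = 1 ∨ e = -1) (A : ℂ) :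
    IsWalk a (-(δ ^ 2 * conj c)) c (δ ^ 2 * conj a) e
      (fun t n => evenInd (t + n) *
        (A * decayRatio a c δ e ^ n * eigenPhase c δ e ^ t))
      (fun t n => evenInd (t + n + 1) *
        (A * (e * conj (eigenPhase c δ e) * decayRatio a c δ e ^ n) * eigenPhase c δ e ^ t)) where
  up t n := by
    rw [show t + 1 + n = t + n + 1 by ring, show t + (n + 1) = t + n + 1 by ring]
    linear_combination (-evenInd (t + n + 1) * A * decayRatio a c δ e ^ n *
      eigenPhase c δ e ^ t) * eigen_up hne hac hδ he
  turn t := by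
    rw [show t + 1 + 0 + 1 = t + 2 by ring, add_zero, evenInd_add_two]
    linear_combination (evenInd t * A * e * eigenPhase c δ e ^ t) * eigenPhase_mul_conj hne hδ he
  down t n := by
    rw [show t + 1 + (n + 1) + 1 = t + n + 1 + 2 by ring, evenInd_add_two,
      show t + (n + 1) = t + n + 1 by ring]
    linear_combination (-evenInd (t + n + 1) * A * decayRatio a c δ e ^ n *
      eigenPhase c δ e ^ t) * eigen_down (a := a) hne hδ he +
      (evenInd (t + n + 1) * A * decayRatio a c δ e ^ n * decayRatio a c δ e *
      eigenPhase c δ e ^ t * e) * eigenPhase_mul_conj hne hδ he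

end

/-- After division by `μ ^ (2 * m)` the even subsequence has summable increments, hence is Cauchy.
-/
theorem exists_tendsto_of_summable {u : ℕ → ℂ} {μ : ℂ} (hμ : ‖μ‖ = 1)
    (hodd : ∀ t, Odd t → u t = 0) (hs : Summable fun t => ‖u (t + 2) - μ ^ 2 * u t‖) :
    ∃ A : ℂ, Tendsto (fun t => u t - evenInd t * (A * μ ^ t)) atTop (𝓝 0) := by
  have hμ0 : μ ≠ 0 := norm_ne_zero_iff.1 (by rw [hμ]; exact one_ne_zero)
  have hcs : CauchySeq fun m => u (2 * m) / μ ^ (2 * m) := by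
    apply cauchySeq_of_summable_dist
    have : Summable fun m => ‖u (2 * m + 2) - μ ^ 2 * u (2 * m)‖ :=
      hs.comp_injective (i := fun m => 2 * m) (mul_right_injective₀ two_ne_zero)
    refine this.congr fun m => ?_
    have h1 : u (2 * m) / μ ^ (2 * m) - u (2 * m + 2) / μ ^ (2 * m + 2) =
        -(u (2 * m + 2) - μ ^ 2 * u (2 * m)) / μ ^ (2 * m + 2) := by
      rw [pow_add]; field_simp; ring
    rw [dist_eq_norm, Nat.succ_eq_add_one, show 2 * (m + 1) = 2 * m + 2 by ring, h1, norm_div,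
      norm_neg, norm_pow, hμ, one_pow, div_one]
  obtain ⟨A, hA⟩ := cauchySeq_tendsto_of_complete hcs
  refine ⟨A, ?_⟩
  rw [Metric.tendsto_atTop] at hA ⊢
  intro ε hε
  obtain ⟨M, hM⟩ := hA ε hε
  refine ⟨2 * M, fun t ht => ?_⟩
  rcases Nat.even_or_odd' t with ⟨m, rfl | rfl⟩
  · have h := hM m (by omega)
    have h1 : u (2 * m) - evenInd (2 * m) * (A * μ ^ (2 * m)) =
        (u (2 * m) / μ ^ (2 * m) - A) * μ ^ (2 * m) := by
      rw [evenInd, if_pos (even_two_mul m)]; field_simp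
    rw [dist_zero_right, h1, norm_mul, norm_pow, hμ, one_pow, mul_one, ← dist_eq_norm]
    exact h
  · have h1 : Odd (2 * m + 1) := odd_two_mul_add_one m
    rw [hodd _ h1, evenInd, if_neg (Nat.not_even_iff_odd.2 h1)]
    simpa using hε

/-! ### Energy bounds, the conserved pairing and the limiting amplitude. -/

namespace IsWalk

variable {a b c d e : ℂ} {U V : ℕ → ℕ → ℂ}

/-- The energy on the first `N` sites grows at most into that on the first `N + 1` sites. -/
theorem energy_step (h : IsWalk a b c d e U V) (he : ‖e‖ = 1)
    (hC : ∀ z w : ℂ, ‖a * z + b * w‖ ^ 2 + ‖c * z + d * w‖ ^ 2 = ‖z‖ ^ 2 + ‖w‖ ^ 2) (t N : ℕ) :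
    ∑ n ∈ Finset.range N, (‖U (t + 1) n‖ ^ 2 + ‖V (t + 1) n‖ ^ 2) ≤
      ∑ n ∈ Finset.range (N + 1), (‖U t n‖ ^ 2 + ‖V t n‖ ^ 2) := by
  have h1 : ∑ n ∈ Finset.range N, ‖V (t + 1) n‖ ^ 2 ≤
      ‖U t 0‖ ^ 2 + ∑ n ∈ Finset.range N, ‖V (t + 1) (n + 1)‖ ^ 2 := by
    have : ‖V (t + 1) 0‖ = ‖U t 0‖ := by rw [h.turn, norm_mul, he, one_mul]
    rw [← this, add_comm (‖V (t + 1) 0‖ ^ 2), ← Finset.sum_range_succ' (fun n => ‖V (t + 1) n‖ ^ 2)]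
    exact Finset.sum_le_sum_of_subset_of_nonneg (Finset.range_mono (Nat.le_succ N))
      fun _ _ _ => by positivity
  have h2 : ∑ n ∈ Finset.range N, (‖U (t + 1) n‖ ^ 2 + ‖V (t + 1) (n + 1)‖ ^ 2) =
      ∑ n ∈ Finset.range N, (‖U t (n + 1)‖ ^ 2 + ‖V t n‖ ^ 2) :=
    Finset.sum_congr rfl fun n _ => by rw [h.up, h.down, hC]
  have h3 : ∑ n ∈ Finset.range N, ‖V t n‖ ^ 2 ≤ ∑ n ∈ Finset.range (N + 1), ‖V t n‖ ^ 2 :=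
    Finset.sum_le_sum_of_subset_of_nonneg (Finset.range_mono (Nat.le_succ N))
      fun _ _ _ => by positivity
  have h4 := Finset.sum_range_succ' (fun n => ‖U t n‖ ^ 2) N
  simp only [Finset.sum_add_distrib] at h2 ⊢
  linarith

theorem energy_le_one (h : IsWalk a b c d e U V) (he : ‖e‖ = 1)
    (hC : ∀ z w : ℂ, ‖a * z + b * w‖ ^ 2 + ‖c * z + d * w‖ ^ 2 = ‖z‖ ^ 2 + ‖w‖ ^ 2)
    (hU : U 0 = fun n => if n = 0 then 1 else 0) (hV : V 0 = 0) (t : ℕ) : ∀ N : ℕ,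
    ∑ n ∈ Finset.range N, (‖U t n‖ ^ 2 + ‖V t n‖ ^ 2) ≤ 1 := by
  induction t with
  | zero =>
    intro N
    have : ∀ n, ‖U 0 n‖ ^ 2 + ‖V 0 n‖ ^ 2 = if n = 0 then 1 else 0 := by
      intro n
      rw [hU, hV]
      by_cases hn : n = 0 <;> simp [hn]
    rw [Finset.sum_congr rfl fun n _ => this n, Finset.sum_ite_eq']
    split_ifs <;> norm_num
  -- The window widens by one site for each step back in time, so the induction hypothesis is needed
  -- for all `N`.
  | succ t ih => exact fun N => (h.energy_step he hC t N).trans (ih (N + 1))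

theorem norm_le_one (h : IsWalk a b c d e U V) (he : ‖e‖ = 1)
    (hC : ∀ z w : ℂ, ‖a * z + b * w‖ ^ 2 + ‖c * z + d * w‖ ^ 2 = ‖z‖ ^ 2 + ‖w‖ ^ 2)
    (hU : U 0 = fun n => if n = 0 then 1 else 0) (hV : V 0 = 0) (t n : ℕ) :
    ‖U t n‖ ≤ 1 ∧ ‖V t n‖ ≤ 1 := by
  have h1 := h.energy_le_one he hC hU hV t (n + 1)
  have h2 := Finset.single_le_sum (f := fun n => ‖U t n‖ ^ 2 + ‖V t n‖ ^ 2)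
    (fun _ _ => by positivity) (Finset.self_mem_range_succ n)
  have h3 : ‖U t n‖ ^ 2 + ‖V t n‖ ^ 2 ≤ 1 := h2.trans h1
  exact ⟨(sq_le_one_iff₀ (norm_nonneg _)).1 (by nlinarith [sq_nonneg ‖V t n‖]),
    (sq_le_one_iff₀ (norm_nonneg _)).1 (by nlinarith [sq_nonneg ‖U t n‖])⟩

end IsWalk

theorem coin_isometry {a c δ : ℂ} (hac : a * conj a + c * conj c = 1) (hδ : δ * conj δ = 1)
    (z w : ℂ) : ‖a * z + -(δ ^ 2 * conj c) * w‖ ^ 2 + ‖c * z + δ ^ 2 * conj a * w‖ ^ 2 =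
      ‖z‖ ^ 2 + ‖w‖ ^ 2 := by
  have : ((‖a * z + -(δ ^ 2 * conj c) * w‖ ^ 2 + ‖c * z + δ ^ 2 * conj a * w‖ ^ 2 : ℝ) : ℂ) =
      ((‖z‖ ^ 2 + ‖w‖ ^ 2 : ℝ) : ℂ) := by
    push_cast
    simp only [← Complex.mul_conj', map_add, map_mul, map_neg, map_pow, Complex.conj_conj]
    have h2 : δ ^ 2 * conj δ ^ 2 = 1 := by rw [← mul_pow, hδ, one_pow]
    linear_combination (z * conj z + w * conj w) * hac +
      w * conj w * (a * conj a + c * conj c) * h2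
  exact_mod_cast this

section

variable {a c δ e : ℂ} {U V : ℕ → ℕ → ℂ}

theorem norm_decayRatio_lt_one (hδ : δ * conj δ = 1)
    (hQ : ‖a‖ ^ 2 / ‖1 - e * c‖ ^ 2 < 1) : ‖decayRatio a c δ e‖ < 1 := by
  rw [← norm_decayRatio_sq hδ] at hQ
  exact (sq_lt_one_iff₀ (norm_nonneg _)).1 hQ

/-- The pairing of the walk with the stationary solution. -/
theorem hasSum_pairing (hne : 1 - e * c ≠ 0) (hac : a * conj a + c * conj c = 1)
    (hδ : δ * conj δ = 1) (he : e = 1 ∨ e = -1) (hQ : ‖a‖ ^ 2 / ‖1 - e * c‖ ^ 2 < 1)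
    (h : IsWalk a (-(δ ^ 2 * conj c)) c (δ ^ 2 * conj a) e U V)
    (hb : ∀ t n, ‖U t n‖ ≤ 1 ∧ ‖V t n‖ ≤ 1)
    (hU : U 0 = fun n => if n = 0 then 1 else 0) (hV : V 0 = 0) (t : ℕ) :
    HasSum (fun n => conj (decayRatio a c δ e) ^ n * (U t n + e * eigenPhase c δ e * V t n))
      (eigenPhase c δ e ^ t) := by
  have hq := norm_decayRatio_lt_one hδ hQ
  set q := decayRatio a c δ e with hqdef
  set μ := eigenPhase c δ e with hμdef
  have hsum : ∀ f : ℕ → ℂ, (∀ n, ‖f n‖ ≤ 1) → Summable fun n => conj q ^ n * f n := by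
    intro f hf
    refine Summable.of_norm_bounded (summable_geometric_of_lt_one (norm_nonneg q) hq) fun n => ?_
    rw [norm_mul, norm_pow, Complex.norm_conj]
    exact mul_le_of_le_one_right (by positivity) (hf n)
  induction t with
  | zero =>
    have : (fun n => conj q ^ n * (U 0 n + e * μ * V 0 n)) = fun n => if n = 0 then 1 else 0 := by
      funext n
      rw [hU, hV]
      by_cases hn : n = 0 <;> simp [hn]
    rw [this, pow_zero]
    exact hasSum_ite_eq 0 1
  | succ t ih =>
    have hUs := hsum (U t) fun n => (hb t n).1
    have hVs := hsum (V t) fun n => (hb t n).2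
    have hWs := hsum (fun n => U t (n + 1)) fun n => (hb t (n + 1)).1
    obtain ⟨x, hx⟩ := hVs
    obtain ⟨y, hy⟩ := hWs
    -- The term at the origin is split off: it evolves by the reflecting coin `e`, while `y` and `x`
    -- collect the amplitudes on which the two-state coin acts.
    have hx' : HasSum (fun n => conj q ^ n * U t n) (U t 0 + conj q * y) := by
      have h1 : HasSum (fun n => conj q ^ (n + 1) * U t (n + 1)) (conj q * y) := by
        refine (hy.mul_left (conj q)).congr_fun ?_
        intro n; ring
      have h2 := (hasSum_nat_add_iff (f := fun n => conj q ^ n * U t n) 1).1 h1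
      simpa [add_comm] using h2
    have hT : U t 0 + conj q * y + e * μ * x = μ ^ t := by
      refine HasSum.unique ((hx'.add (hx.mul_left (e * μ))).congr_fun ?_) ih
      intro n; ring
    have hU1 : HasSum (fun n => conj q ^ n * U (t + 1) n) (a * y + -(δ ^ 2 * conj c) * x) := by
      refine ((hy.mul_left a).add (hx.mul_left (-(δ ^ 2 * conj c)))).congr_fun ?_
      intro n; rw [h.up]; ring
    have hV1 : HasSum (fun n => conj q ^ n * V (t + 1) n)
        (conj q * (c * y + δ ^ 2 * conj a * x) + e * U t 0) := by
      have h1 : HasSum (fun n => conj q ^ (n + 1) * V (t + 1) (n + 1))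
          (conj q * (c * y + δ ^ 2 * conj a * x)) := by
        refine (((hy.mul_left c).add (hx.mul_left (δ ^ 2 * conj a))).mul_left
          (conj q)).congr_fun ?_
        intro n; rw [h.down]; ring
      have h2 := (hasSum_nat_add_iff (f := fun n => conj q ^ n * V (t + 1) n) 1).1 h1
      simpa [h.turn] using h2
    have := hU1.add (hV1.mul_left (e * μ))
    have hval : a * y + -(δ ^ 2 * conj c) * x +
        e * μ * (conj q * (c * y + δ ^ 2 * conj a * x) + e * U t 0) = μ ^ (t + 1) := by
      rw [pow_succ μ t, ← hT]
      linear_combination y * eigen_up_adjoint (a := a) hne hδ he +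
        x * eigen_down_adjoint hne hac hδ he + μ * U t 0 * sign_mul_self he
    rw [← hval]
    refine this.congr_fun ?_
    intro n; ring

end

section

variable {a c δ e : ℂ} {U V : ℕ → ℕ → ℂ}

theorem norm_eigenPhase (hne : 1 - e * c ≠ 0) (hδ : δ * conj δ = 1) (he : e = 1 ∨ e = -1) :
    ‖eigenPhase c δ e‖ = 1 := by
  have := eigenPhase_mul_conj hne hδ he
  rw [Complex.mul_conj'] at this
  exact (pow_eq_one_iff_of_nonneg (norm_nonneg _) two_ne_zero).1 (by exact_mod_cast this)

/-- Along even times the parity factor is constant, and dividing by the unimodular `μ ^ (2 * m)`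
removes the oscillation. -/
theorem tendsto_even {f g : ℕ → ℂ} {A μ z : ℂ} (hμ : ‖μ‖ = 1) {n : ℕ}
    (hg : g = fun t => evenInd (t + n) * (A * z * μ ^ t))
    (h : Tendsto (fun t => f t - g t) atTop (𝓝 0)) :
    Tendsto (fun m => (μ ^ (2 * m))⁻¹ * f (2 * m)) atTop (𝓝 (evenInd n * (A * z))) := by
  have hμ0 : μ ≠ 0 := norm_ne_zero_iff.1 (by rw [hμ]; exact one_ne_zero)
  have h1 : Tendsto (fun m : ℕ => 2 * m) atTop atTop :=
    tendsto_atTop_mono (fun m => show m ≤ 2 * m by omega) tendsto_id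
  have h2 := h.comp h1
  have h3 : Tendsto (fun m => (μ ^ (2 * m))⁻¹ * (f (2 * m) - g (2 * m))) atTop (𝓝 0) := by
    rw [tendsto_zero_iff_norm_tendsto_zero] at h2 ⊢
    refine h2.congr fun m => ?_
    simp [hμ]
  have h4 : (fun m => (μ ^ (2 * m))⁻¹ * f (2 * m)) =
      fun m => (μ ^ (2 * m))⁻¹ * (f (2 * m) - g (2 * m)) + evenInd n * (A * z) := by
    funext m
    have : evenInd (2 * m + n) = evenInd n := by
      simp only [evenInd, Nat.even_add, even_two_mul, true_iff]
    rw [hg]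
    simp only [this]
    field_simp
    ring
  rw [h4]
  simpa using h3.add_const (evenInd n * (A * z))

/-- The amplitude of the stationary solution in the limit is `max 0 (1 - |q|²)`. -/
theorem limitAmp_eq_of_tendsto (hne : 1 - e * c ≠ 0) (hac : a * conj a + c * conj c = 1)
    (hδ : δ * conj δ = 1) (he : e = 1 ∨ e = -1)
    (h : IsWalk a (-(δ ^ 2 * conj c)) c (δ ^ 2 * conj a) e U V)
    (hU : U 0 = fun n => if n = 0 then 1 else 0) (hV : V 0 = 0) {A : ℂ}
    (hlimU : ∀ n, Tendsto (fun t => U t n - evenInd (t + n) *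
        (A * decayRatio a c δ e ^ n * eigenPhase c δ e ^ t)) atTop (𝓝 0))
    (hlimV : ∀ n, Tendsto (fun t => V t n - evenInd (t + n + 1) *
        (A * (e * conj (eigenPhase c δ e) * decayRatio a c δ e ^ n) * eigenPhase c δ e ^ t))
        atTop (𝓝 0)) :
    A = limitAmp a c e := by
  have hnorm : ‖e‖ = 1 := by rcases he with rfl | rfl <;> simp
  have hC := coin_isometry hac hδ
  have hb := h.norm_le_one hnorm hC hU hV
  have hμ := norm_eigenPhase hne hδ he
  have hUe := fun n => tendsto_even hμ rfl (hlimU n)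
  have hVe := fun n => tendsto_even (n := n + 1) hμ rfl (hlimV n)
  by_cases hQ : ‖a‖ ^ 2 / ‖1 - e * c‖ ^ 2 < 1
  · have hq := norm_decayRatio_lt_one (a := a) hδ hQ
    have hpair := hasSum_pairing hne hac hδ he hQ h hb hU hV
    have hqq := norm_decayRatio_sq (a := a) (c := c) (e := e) hδ
    have hee := sign_mul_self he
    have hμμ := eigenPhase_mul_conj hne hδ he
    set q := decayRatio a c δ e
    set μ := eigenPhase c δ e
    have hμ0 : μ ≠ 0 := norm_ne_zero_iff.1 (by rw [hμ]; exact one_ne_zero)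
    -- At each `n` only one of `U` and `V` survives in the limit, according to parity; either way
    -- the summand tends to `A |q|^(2n)`. The normalised pairing always equals `1`, so the geometric
    -- sum will give `A / (1 - |q|²) = 1`.
    have hpt : ∀ n, Tendsto (fun m => (μ ^ (2 * m))⁻¹ *
        (conj q ^ n * (U (2 * m) n + e * μ * V (2 * m) n))) atTop
        (𝓝 (A * ((‖q‖ : ℂ) ^ 2) ^ n)) := by
      intro n
      have h1 := ((hUe n).add ((hVe n).const_mul (e * μ))).const_mul (conj q ^ n)
      refine (h1.congr fun m => by ring).trans (le_of_eq ?_)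
      congr 1
      rw [← Complex.mul_conj', mul_pow]
      linear_combination (A * q ^ n * conj q ^ n) * evenInd_add_succ n +
        conj q ^ n * evenInd (n + 1) * A * q ^ n * hee +
        conj q ^ n * evenInd (n + 1) * A * q ^ n * e * e * hμμ
    have hdom := tendsto_tsum_of_dominated_convergence (bound := fun n => 2 * ‖q‖ ^ n)
      ((summable_geometric_of_lt_one (norm_nonneg q) hq).mul_left 2) hpt
      (Eventually.of_forall fun m n => by
        have h2 : ‖U (2 * m) n + e * μ * V (2 * m) n‖ ≤ 2 := by
          refine (norm_add_le _ _).trans ?_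
          rw [norm_mul, norm_mul, hnorm, hμ]
          linarith [(hb (2 * m) n).1, (hb (2 * m) n).2]
        rw [norm_mul, norm_mul, norm_inv, norm_pow, norm_pow, hμ, Complex.norm_conj, one_pow,
          inv_one, one_mul, mul_comm]
        exact mul_le_mul_of_nonneg_right h2 (by positivity))
    have h1 : ∀ m, ∑' n, (μ ^ (2 * m))⁻¹ * (conj q ^ n * (U (2 * m) n + e * μ * V (2 * m) n)) =
        1 := by
      intro m
      rw [((hpair (2 * m)).mul_left (μ ^ (2 * m))⁻¹).tsum_eq]
      exact inv_mul_cancel₀ (pow_ne_zero _ hμ0)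
    have hq2 : ‖((‖q‖ : ℂ) ^ 2)‖ < 1 := by
      rw [norm_pow, Complex.norm_real, norm_norm]
      exact pow_lt_one₀ (norm_nonneg _) hq two_ne_zero
    simp only [h1, tsum_mul_left, tsum_geometric_of_norm_lt_one hq2] at hdom
    have h3 := tendsto_nhds_unique tendsto_const_nhds hdom
    have h4 : (1 - (‖q‖ : ℂ) ^ 2) ≠ 0 := by
      intro h0
      rw [← sub_eq_zero.1 h0, norm_one] at hq2
      exact lt_irrefl _ hq2
    have h5 : A = 1 - (‖q‖ : ℂ) ^ 2 := by
      field_simp at h3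
      exact h3.symm
    rw [h5, limitAmp, max_eq_right (by linarith), ← hqq]
    push_cast
    rfl
  · have hA0 : limitAmp a c e = 0 := max_eq_left (by linarith)
    rw [hA0, Complex.ofReal_zero]
    by_contra hA
    have hq1 : 1 ≤ ‖decayRatio a c δ e‖ := by
      rw [← norm_decayRatio_sq hδ, not_lt] at hQ
      exact (one_le_sq_iff₀ (norm_nonneg _)).1 hQ
    -- Since `|q| ≥ 1`, each of the first `M` indices carries limiting energy at least `|A|²`,
    -- through `U` or `V` depending on parity, while the total energy stays at most `1`.
    have hbound : ∀ M : ℕ, (M : ℝ) * ‖A‖ ^ 2 ≤ 1 := by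
      intro M
      have h1 : Tendsto (fun m => ∑ n ∈ Finset.range M,
          (‖(eigenPhase c δ e ^ (2 * m))⁻¹ * U (2 * m) n‖ ^ 2 +
            ‖(eigenPhase c δ e ^ (2 * m))⁻¹ * V (2 * m) n‖ ^ 2)) atTop
          (𝓝 (∑ n ∈ Finset.range M, (‖evenInd n * (A * decayRatio a c δ e ^ n)‖ ^ 2 +
            ‖evenInd (n + 1) * (A * (e * conj (eigenPhase c δ e) *
              decayRatio a c δ e ^ n))‖ ^ 2))) :=
        tendsto_finsetSum _ fun n _ => ((hUe n).norm.pow 2).add ((hVe n).norm.pow 2)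
      have h2 := le_of_tendsto' h1 (b := 1) fun m => by
        refine le_trans (le_of_eq ?_) (h.energy_le_one hnorm hC hU hV (2 * m) M)
        refine Finset.sum_congr rfl fun n _ => ?_
        simp [hμ]
      refine le_trans ?_ h2
      have h3 : ∑ n ∈ Finset.range M, ‖A‖ ^ 2 = M * ‖A‖ ^ 2 := by simp
      rw [← h3]
      refine Finset.sum_le_sum fun n _ => ?_
      have h4 : ‖A‖ ≤ ‖A‖ * ‖decayRatio a c δ e‖ ^ n :=
        le_mul_of_one_le_right (norm_nonneg _) (one_le_pow₀ hq1)
      have h5 : ‖A‖ ^ 2 ≤ (‖A‖ * ‖decayRatio a c δ e‖ ^ n) ^ 2 :=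
        pow_le_pow_left₀ (norm_nonneg _) h4 2
      simp only [evenInd, Nat.even_add_one]
      split_ifs with hn <;> simp [hnorm, hμ, h5]
    obtain ⟨M, hM⟩ := exists_nat_gt (1 / ‖A‖ ^ 2)
    have hpos : 0 < ‖A‖ ^ 2 := by positivity
    rw [div_lt_iff₀ hpos] at hM
    linarith [hbound M]

/-- The walk on a half line converges pointwise to the stationary solution. -/
theorem tendsto_sub_stationary (ha : a ≠ 0) (hc : c ≠ 0) (hac : a * conj a + c * conj c = 1)
    (hδ : δ * conj δ = 1) (he : e = 1 ∨ e = -1)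
    (h : IsWalk a (-(δ ^ 2 * conj c)) c (δ ^ 2 * conj a) e U V)
    (hU : U 0 = fun n => if n = 0 then 1 else 0) (hV : V 0 = 0) (n : ℕ) :
    Tendsto (fun t => U t n - evenInd (t + n) *
        (limitAmp a c e * decayRatio a c δ e ^ n * eigenPhase c δ e ^ t)) atTop (𝓝 0) ∧
    Tendsto (fun t => V t n - evenInd (t + n + 1) *
        (limitAmp a c e * (e * conj (eigenPhase c δ e) * decayRatio a c δ e ^ n) *
          eigenPhase c δ e ^ t)) atTop (𝓝 0) := by
  have hne := one_sub_sign_mul_ne_zero ha hac he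
  obtain ⟨U', V', h', hU', hV', hs⟩ := exists_isWalk ha hc hac hδ he
  obtain ⟨rfl, rfl⟩ := h.ext_of_zero h' (hU.trans hU'.symm) (hV.trans hV'.symm)
  have hpar := h.parity (fun n hn => by
    rw [hU]
    rcases n with _ | n
    · simp at hn
    · simp) (fun n => by rw [hV]; rfl)
  obtain ⟨A, hA⟩ := exists_tendsto_of_summable (norm_eigenPhase hne hδ he)
    (fun t ht => (hpar t 0).1 ht) hs
  -- The difference from the stationary solution is again a walk, so decay at the origin suffices.
  have hw := h.linear_combination (isWalk_stationary hne hac hδ he A) 1 (-1)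
  have key := fun n => hw.tendsto_zero ha (hA.congr fun t => by simp; ring) n
  have hlimU : ∀ n, Tendsto (fun t => U t n - evenInd (t + n) *
        (A * decayRatio a c δ e ^ n * eigenPhase c δ e ^ t)) atTop (𝓝 0) :=
    fun n => (key n).1.congr fun t => by ring
  have hlimV : ∀ n, Tendsto (fun t => V t n - evenInd (t + n + 1) *
        (A * (e * conj (eigenPhase c δ e) * decayRatio a c δ e ^ n) * eigenPhase c δ e ^ t))
        atTop (𝓝 0) :=
    fun n => (key n).2.congr fun t => by ring
  rw [← limitAmp_eq_of_tendsto hne hac hδ he h hU hV hlimU hlimV]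
  exact ⟨hlimU n, hlimV n⟩

end

/-! ### The evolution operator in coordinates. -/

section Evolution

variable {κ : ℕ} (C : Matrix (Fin 2) (Fin 2) ℂ)

theorem evolution_single (k : Ket κ) (z : ℂ) :
    evolution κ C (Finsupp.single k z) = z • shiftOp κ (coinKet C k) := by
  simp [evolution, coinOp, Finsupp.linearCombination_single]

theorem shiftOp_ket (k : Ket κ) : shiftOp κ (ket k) = ket (shiftKet k) := by
  simp [shiftOp, ket, Finsupp.linearCombination_single]

theorem evolution_single_origin (r : Fin κ) (z : ℂ) :
    evolution κ C (Finsupp.single (.origin r) z) =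
      z • ∑ j : Fin κ, grover κ j r • ket (.arm j 0 1) := by
  simp only [evolution_single, coinKet, map_sum, map_smul, shiftOp_ket, shiftKet]

theorem evolution_single_arm_zero (r : Fin κ) (l : Fin 2) (z : ℂ) :
    evolution κ C (Finsupp.single (.arm r 0 l) z) =
      z • (C 0 l • ket (.origin r) + C 1 l • ket (.arm r 1 1)) := by
  simp only [evolution_single, coinKet, Fin.sum_univ_two, map_add, map_smul, shiftOp_ket, shiftKet]

theorem evolution_single_arm_succ (r : Fin κ) (n : ℕ) (l : Fin 2) (z : ℂ) :
    evolution κ C (Finsupp.single (.arm r (n + 1) l) z) =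
      z • (C 0 l • ket (.arm r n 0) + C 1 l • ket (.arm r (n + 2) 1)) := by
  simp only [evolution_single, coinKet, Fin.sum_univ_two, map_add, map_smul, shiftOp_ket, shiftKet]

open Classical in
theorem evolution_apply_origin (s : State κ) (r : Fin κ) :
    evolution κ C s (.origin r) = C 0 0 * s (.arm r 0 0) + C 0 1 * s (.arm r 0 1) := by
  induction s using Finsupp.induction_linear with
  | zero => simp
  | add f g hf hg => simp only [map_add, Finsupp.add_apply, hf, hg]; ring
  | single k z =>
    rcases k with j | ⟨j, _ | n, l⟩
    · simp [evolution_single_origin, ket]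
    · rw [evolution_single_arm_zero]
      fin_cases l <;> by_cases hj : j = r <;> simp [ket, hj, mul_comm]
    · rw [evolution_single_arm_succ]
      simp [ket]

open Classical in
theorem evolution_apply_up (s : State κ) (r : Fin κ) (n : ℕ) :
    evolution κ C s (.arm r n 0) =
      C 0 0 * s (.arm r (n + 1) 0) + C 0 1 * s (.arm r (n + 1) 1) := by
  induction s using Finsupp.induction_linear with
  | zero => simp
  | add f g hf hg => simp only [map_add, Finsupp.add_apply, hf, hg]; ring
  | single k z =>
    rcases k with j | ⟨j, _ | m, l⟩
    · simp [evolution_single_origin, ket]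
    · rw [evolution_single_arm_zero]
      simp [ket]
    · rw [evolution_single_arm_succ]
      fin_cases l <;> by_cases hj : j = r <;> by_cases hm : m = n <;>
        simp [ket, hj, hm, mul_comm]

open Classical in
theorem evolution_apply_down_zero (s : State κ) (r : Fin κ) :
    evolution κ C s (.arm r 0 1) = ∑ j, grover κ r j * s (.origin j) := by
  induction s using Finsupp.induction_linear with
  | zero => simp
  | add f g hf hg =>
    simp only [map_add, Finsupp.add_apply, hf, hg, mul_add, Finset.sum_add_distrib]
  | single k z =>
    rcases k with j | ⟨j, _ | m, l⟩
    · simp [evolution_single_origin, ket, Finsupp.single_apply, mul_comm]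
    · rw [evolution_single_arm_zero]
      simp [ket]
    · rw [evolution_single_arm_succ]
      simp [ket]

open Classical in
theorem evolution_apply_down_succ (s : State κ) (r : Fin κ) (n : ℕ) :
    evolution κ C s (.arm r (n + 1) 1) = C 1 0 * s (.arm r n 0) + C 1 1 * s (.arm r n 1) := by
  induction s using Finsupp.induction_linear with
  | zero => simp
  | add f g hf hg => simp only [map_add, Finsupp.add_apply, hf, hg]; ring
  | single k z =>
    rcases k with j | ⟨j, _ | m, l⟩
    · simp [evolution_single_origin, ket]
    · rw [evolution_single_arm_zero]
      rcases n with _ | n <;> fin_cases l <;> by_cases hj : j = r <;> simp [ket, hj, mul_comm]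
    · rw [evolution_single_arm_succ]
      fin_cases l <;> by_cases hj : j = r <;> by_cases hm : m + 1 = n <;>
        simp [ket, Finsupp.single_apply, hj, hm, mul_comm]

end Evolution

/-! ### Reduction to two walks on one half line. -/

section Reduction

variable {κ : ℕ}

open Classical in
theorem initialState_apply (ψ : Fin κ → ℂ) :
    (∀ r, initialState ψ (.origin r) = ψ r) ∧ ∀ r n l, initialState ψ (.arm r n l) = 0 := by
  constructor <;> intros <;>
    simp [initialState, ket, Finsupp.single_apply, Finsupp.finsetSum_apply]

theorem stateAt_succ (C : Matrix (Fin 2) (Fin 2) ℂ) (ψ : Fin κ → ℂ) (t : ℕ) :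
    stateAt C ψ (t + 1) = evolution κ C (stateAt C ψ t) := by
  rw [stateAt, pow_succ']; rfl

/-- The mean of the initial amplitudes. -/
noncomputable def mean (ψ : Fin κ → ℂ) : ℂ := (∑ j, ψ j) / κ

/-- The constant part of the coin state has Grover eigenvalue `1`; the deviation from the mean has
eigenvalue `-1`. -/
theorem sum_grover_mul (hκ : 1 ≤ κ) (ψ : Fin κ → ℂ) (r : Fin κ) (z w : ℂ) :
    ∑ j, grover κ r j * (mean ψ * z + (ψ j - mean ψ) * w) =
      mean ψ * z - (ψ r - mean ψ) * w := by
  have hκ0 : (κ : ℂ) ≠ 0 := by exact_mod_cast (by omega : κ ≠ 0)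
  have hg : ∀ j, grover κ r j = 2 / (κ : ℂ) - if r = j then 1 else 0 := by
    intro j
    simp only [grover, Matrix.of_apply]
    split_ifs <;> ring
  have hs : ∑ j, ψ j = κ * mean ψ := by rw [mean]; field_simp
  simp only [hg, sub_mul, Finset.sum_sub_distrib, ite_mul, one_mul, zero_mul,
    Finset.sum_ite_eq, Finset.mem_univ, if_true]
  simp only [← Finset.mul_sum, Finset.sum_add_distrib, Finset.sum_sub_distrib, ← Finset.sum_mul,
    hs, Finset.sum_const, Finset.card_univ, Fintype.card_fin, nsmul_eq_mul]
  field_simp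
  ring

/-- On each half line the walk is a superposition of two walks on a single half line, with
reflecting coins `1` and `-1`. -/
theorem stateAt_eq (hκ : 1 ≤ κ) {a b c d : ℂ} {U V U' V' : ℕ → ℕ → ℂ}
    (h : IsWalk a b c d 1 U V) (hU : U 0 = fun n => if n = 0 then 1 else 0) (hV : V 0 = 0)
    (h' : IsWalk a b c d (-1) U' V') (hU' : U' 0 = fun n => if n = 0 then 1 else 0)
    (hV' : V' 0 = 0) (ψ : Fin κ → ℂ) (t : ℕ) : ∀ r,
    stateAt !![a, b; c, d] ψ t (.origin r) = mean ψ * U t 0 + (ψ r - mean ψ) * U' t 0 ∧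
    ∀ n, stateAt !![a, b; c, d] ψ t (.arm r n 0) =
        mean ψ * U t (n + 1) + (ψ r - mean ψ) * U' t (n + 1) ∧
      stateAt !![a, b; c, d] ψ t (.arm r n 1) = mean ψ * V t n + (ψ r - mean ψ) * V' t n := by
  induction t with
  | zero =>
    intro r
    have : stateAt !![a, b; c, d] ψ 0 = initialState ψ := rfl
    rw [this, (initialState_apply ψ).1]
    refine ⟨by simp [hU, hU'], fun n => ?_⟩
    rw [(initialState_apply ψ).2, (initialState_apply ψ).2]
    simp [hU, hU', hV, hV']
  | succ t ih =>
    intro r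
    rw [stateAt_succ]
    refine ⟨?_, fun n => ⟨?_, ?_⟩⟩
    · rw [evolution_apply_origin, ((ih r).2 0).1, ((ih r).2 0).2, h.up, h'.up]
      simp; ring
    · rw [evolution_apply_up, ((ih r).2 (n + 1)).1, ((ih r).2 (n + 1)).2, h.up, h'.up]
      simp; ring
    · cases n with
      | zero =>
        rw [evolution_apply_down_zero, h.turn, h'.turn,
          Finset.sum_congr rfl fun j _ => by rw [(ih j).1], sum_grover_mul hκ]
        ring
      | succ n =>
        rw [evolution_apply_down_succ, ((ih r).2 n).1, ((ih r).2 n).2, h.down, h'.down]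
        simp; ring

/-- The second column of a unitary matrix is determined by the first and the determinant. Taking `δ`
to be a square root of the determinant lets `μ` and `q` be written in terms of `δ`. -/
theorem exists_unitary_parameter {a b c d : ℂ}
    (hC : !![a, b; c, d] ∈ Matrix.unitaryGroup (Fin 2) ℂ) :
    ∃ δ : ℂ, δ * conj δ = 1 ∧ a * conj a + c * conj c = 1 ∧ b = -(δ ^ 2 * conj c) ∧
      d = δ ^ 2 * conj a := by
  rw [Matrix.mem_unitaryGroup_iff'] at hC
  have h00 := congrFun (congrFun hC 0) 0
  have h01 := congrFun (congrFun hC 0) 1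
  have h11 := congrFun (congrFun hC 1) 1
  simp [Matrix.mul_apply, Fin.sum_univ_two] at h00 h01 h11
  obtain ⟨δ, hδ⟩ := IsAlgClosed.exists_pow_nat_eq (a * d - b * c) (n := 2) two_pos
  have hd : d = δ ^ 2 * conj a := by
    rw [hδ]; linear_combination (-d) * h00 + c * h01
  have hb : b = -(δ ^ 2 * conj c) := by
    rw [hδ]; linear_combination (-b) * h00 + a * h01
  have hac : a * conj a + c * conj c = 1 := by linear_combination h00
  refine ⟨δ, ?_, hac, hb, hd⟩
  have h4 : (δ * conj δ) ^ 2 = 1 := by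
    rw [hb, hd] at h11
    simp only [map_neg, map_mul, map_pow, Complex.conj_conj] at h11
    linear_combination h11 - (δ * conj δ) ^ 2 * hac
  rw [Complex.mul_conj'] at h4 ⊢
  have h5 : (‖δ‖ ^ 2) ^ 2 = 1 := by exact_mod_cast h4
  have h6 := (pow_eq_one_iff_of_nonneg (sq_nonneg ‖δ‖) two_ne_zero).1 h5
  exact_mod_cast h6

end Reduction

/-! ### Identification of the constants. -/

section Constants

variable {a c δ : ℂ}

theorem norm_mul_cosPhase (hc : c ≠ 0) : ‖c‖ * cosPhase c = c.re := by
  rw [cosPhase, Complex.cos_arg hc, mul_div_cancel₀ _ (norm_ne_zero_iff.2 hc)]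

theorem neg_one_le_cosPhase (c : ℂ) : -1 ≤ cosPhase c := Real.neg_one_le_cos _

theorem cosPhase_le_one (c : ℂ) : cosPhase c ≤ 1 := Real.cos_le_one _

theorem Kminus_eq (hc : c ≠ 0) : Kminus c = 1 - 2 * (‖c‖ * cosPhase c) + ‖c‖ ^ 2 := by
  rw [norm_mul_cosPhase hc, Kminus, Complex.sq_norm, Complex.sq_norm, Complex.normSq_apply,
    Complex.normSq_apply]
  simp; ring

theorem Kplus_eq (hc : c ≠ 0) : Kplus c = 1 + 2 * (‖c‖ * cosPhase c) + ‖c‖ ^ 2 := by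
  rw [norm_mul_cosPhase hc, Kplus, Complex.sq_norm, Complex.sq_norm, Complex.normSq_apply,
    Complex.normSq_apply]
  simp; ring

theorem norm_sq_add_norm_sq (hac : a * conj a + c * conj c = 1) : ‖a‖ ^ 2 + ‖c‖ ^ 2 = 1 := by
  rw [Complex.mul_conj', Complex.mul_conj'] at hac
  exact_mod_cast hac

theorem Kminus_pos (ha : a ≠ 0) (hac : a * conj a + c * conj c = 1) : 0 < Kminus c := by
  have := one_sub_sign_mul_ne_zero ha hac (Or.inl rfl)
  rw [one_mul] at this
  exact pow_pos (norm_pos_iff.2 this) 2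

theorem Kplus_pos (ha : a ≠ 0) (hac : a * conj a + c * conj c = 1) : 0 < Kplus c := by
  have := one_sub_sign_mul_ne_zero ha hac (Or.inr rfl)
  rw [neg_one_mul, sub_neg_eq_add] at this
  exact pow_pos (norm_pos_iff.2 this) 2

/-- Expand `|1 - c|²` and use `|a|² = 1 - |c|²`. The factor `|c| - cos φ` is the source of both the
threshold in the indicator and the numerator of `gammaMinus`. -/
theorem one_sub_div_Kminus (ha : a ≠ 0) (hc : c ≠ 0) (hac : a * conj a + c * conj c = 1) :
    1 - ‖a‖ ^ 2 / Kminus c = 2 * ‖c‖ * (‖c‖ - cosPhase c) / Kminus c := by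
  have hK := Kminus_pos ha hac
  have h1 := norm_sq_add_norm_sq hac
  rw [one_sub_div hK.ne', div_left_inj' hK.ne']
  linear_combination Kminus_eq hc - h1

theorem one_sub_div_Kplus (ha : a ≠ 0) (hc : c ≠ 0) (hac : a * conj a + c * conj c = 1) :
    1 - ‖a‖ ^ 2 / Kplus c = 2 * ‖c‖ * (‖c‖ + cosPhase c) / Kplus c := by
  have hK := Kplus_pos ha hac
  have h1 := norm_sq_add_norm_sq hac
  rw [one_sub_div hK.ne', div_left_inj' hK.ne']
  linear_combination Kplus_eq hc - h1

theorem div_Kminus_lt_one_iff (ha : a ≠ 0) (hc : c ≠ 0) (hac : a * conj a + c * conj c = 1) :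
    ‖a‖ ^ 2 / Kminus c < 1 ↔ cosPhase c < ‖c‖ := by
  have hK := Kminus_pos ha hac
  have hc' := norm_pos_iff.2 hc
  rw [← sub_pos, one_sub_div_Kminus ha hc hac, div_pos_iff_of_pos_right hK,
    mul_pos_iff_of_pos_left (by positivity), sub_pos]

theorem div_Kplus_lt_one_iff (ha : a ≠ 0) (hc : c ≠ 0) (hac : a * conj a + c * conj c = 1) :
    ‖a‖ ^ 2 / Kplus c < 1 ↔ -‖c‖ < cosPhase c := by
  have hK := Kplus_pos ha hac
  have hc' := norm_pos_iff.2 hc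
  rw [← sub_pos, one_sub_div_Kplus ha hc hac, div_pos_iff_of_pos_right hK,
    mul_pos_iff_of_pos_left (by positivity), neg_lt_iff_pos_add']

theorem limitAmp_one (ha : a ≠ 0) (hc : c ≠ 0) (hac : a * conj a + c * conj c = 1) :
    limitAmp a c 1 = (Set.Ico (-1) ‖c‖).indicator (fun _ => (1 : ℝ)) (cosPhase c) *
      (2 * ‖c‖ * (‖c‖ - cosPhase c) / Kminus c) := by
  rw [limitAmp, one_mul, ← Kminus, ← one_sub_div_Kminus ha hc hac]
  by_cases h : cosPhase c < ‖c‖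
  · rw [Set.indicator_of_mem (Set.mem_Ico.2 ⟨neg_one_le_cosPhase c, h⟩), one_mul,
      max_eq_right (by linarith [(div_Kminus_lt_one_iff ha hc hac).2 h])]
  · rw [Set.indicator_of_notMem (fun h' => h (Set.mem_Ico.1 h').2), zero_mul,
      max_eq_left (by linarith [not_lt.1 (mt (div_Kminus_lt_one_iff ha hc hac).1 h)])]

theorem limitAmp_neg_one (ha : a ≠ 0) (hc : c ≠ 0) (hac : a * conj a + c * conj c = 1) :
    limitAmp a c (-1) = (Set.Ioc (-‖c‖) 1).indicator (fun _ => (1 : ℝ)) (cosPhase c) *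
      (2 * ‖c‖ * (‖c‖ + cosPhase c) / Kplus c) := by
  rw [limitAmp, neg_one_mul, sub_neg_eq_add, ← Kplus, ← one_sub_div_Kplus ha hc hac]
  by_cases h : -‖c‖ < cosPhase c
  · rw [Set.indicator_of_mem (Set.mem_Ioc.2 ⟨h, cosPhase_le_one c⟩), one_mul,
      max_eq_right (by linarith [(div_Kplus_lt_one_iff ha hc hac).2 h])]
  · rw [Set.indicator_of_notMem (fun h' => h (Set.mem_Ioc.1 h').1), zero_mul,
      max_eq_left (by linarith [not_lt.1 (mt (div_Kplus_lt_one_iff ha hc hac).1 h)])]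

theorem indicator_mul_indicator (c : ℂ) :
    (Set.Ioo (-‖c‖) ‖c‖).indicator (fun _ => (1 : ℝ)) (cosPhase c) =
      (Set.Ico (-1) ‖c‖).indicator (fun _ => (1 : ℝ)) (cosPhase c) *
        (Set.Ioc (-‖c‖) 1).indicator (fun _ => (1 : ℝ)) (cosPhase c) := by
  have h1 := neg_one_le_cosPhase c
  have h2 := cosPhase_le_one c
  simp only [Set.indicator, Set.mem_Ioo, Set.mem_Ico, Set.mem_Ioc, h1, h2, true_and,
    and_true]
  split_ifs <;> simp_all

theorem indicator_mul_self (s : Set ℝ) (x : ℝ) :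
    s.indicator (fun _ => (1 : ℝ)) x * s.indicator (fun _ => (1 : ℝ)) x =
      s.indicator (fun _ => (1 : ℝ)) x := by
  simp only [Set.indicator]
  split_ifs <;> simp

theorem norm_Kcross (c : ℂ) : ‖Kcross c‖ = ‖1 - c‖ * ‖1 + c‖ := by
  rw [Kcross, norm_mul, ← Complex.norm_conj (1 + c), map_add, map_one]

theorem sqrt_Kplus_mul_Kminus (c : ℂ) : √(Kplus c * Kminus c) = ‖Kcross c‖ := by
  rw [norm_Kcross, Kplus, Kminus, ← mul_pow, Real.sqrt_sq (by positivity), mul_comm]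

theorem Kcross_ne_zero (ha : a ≠ 0) (hac : a * conj a + c * conj c = 1) : Kcross c ≠ 0 := by
  have h1 := one_sub_sign_mul_ne_zero ha hac (Or.inl rfl)
  have h2 := one_sub_sign_mul_ne_zero ha hac (Or.inr rfl)
  rw [one_mul] at h1
  rw [neg_one_mul, sub_neg_eq_add] at h2
  rw [← norm_ne_zero_iff, norm_Kcross]
  exact mul_ne_zero (norm_ne_zero_iff.2 h1) (norm_ne_zero_iff.2 h2)

/-- The principal root is the phase of `K_×`, since the real part of `K_×` is `1 - |c|² > 0`. -/
theorem phaseRoot_eq (ha : a ≠ 0) (hac : a * conj a + c * conj c = 1) :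
    phaseRoot c = Kcross c / ‖Kcross c‖ := by
  have hk := Kcross_ne_zero ha hac
  have hm : (‖Kcross c‖ : ℂ) ≠ 0 := by exact_mod_cast norm_ne_zero_iff.2 hk
  have hk' : conj (Kcross c) ≠ 0 := (map_ne_zero _).2 hk
  have h1 : Kcross c / conj (Kcross c) = (Kcross c / ‖Kcross c‖) ^ 2 := by
    rw [div_pow, ← Complex.mul_conj']
    field_simp
  have h2 : 0 < (Kcross c / ‖Kcross c‖).re := by
    rw [Complex.div_ofReal_re]
    refine div_pos ?_ (norm_pos_iff.2 hk)
    have h3 : (Kcross c).re = 1 - ‖c‖ ^ 2 := by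
      rw [Complex.sq_norm, Complex.normSq_apply]
      simp [Kcross]; ring
    have h4 := norm_lt_one ha hac
    rw [h3]
    nlinarith [norm_nonneg c]
  rw [phaseRoot, h1, one_div, Complex.sq_cpow_two_inv h2]

/-- The relative phase of the two eigenvalues, in which `δ` cancels; it drives the time dependence
of the interference term. -/
theorem conj_eigenPhase_mul (ha : a ≠ 0) (hac : a * conj a + c * conj c = 1)
    (hδ : δ * conj δ = 1) :
    conj (eigenPhase c δ 1) * eigenPhase c δ (-1) = phaseRoot c := by
  rw [phaseRoot_eq ha hac, norm_Kcross]
  simp only [eigenPhase, map_div₀, map_mul, map_sub, map_one, Complex.conj_conj,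
    Complex.conj_ofReal, one_mul, neg_one_mul, sub_neg_eq_add, Kcross]
  push_cast
  rw [div_mul_div_comm]
  congr 1
  linear_combination (1 - c) * (1 + conj c) * hδ

theorem conj_decayRatio_mul (hδ : δ * conj δ = 1) :
    conj (decayRatio a c δ 1) * decayRatio a c δ (-1) = ((‖a‖ ^ 2 / ‖Kcross c‖ : ℝ) : ℂ) := by
  rw [norm_Kcross]
  simp only [decayRatio, map_div₀, map_mul, Complex.conj_conj, Complex.conj_ofReal, one_mul,
    neg_one_mul, sub_neg_eq_add]
  push_cast
  rw [div_mul_div_comm, ← Complex.mul_conj']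
  congr 1
  linear_combination a * conj a * hδ

/-- The phase-dependent factor of the interference term. -/
noncomputable def crossFactor (a c : ℂ) (x t : ℕ) : ℂ :=
  phaseRoot c ^ t * if x = 0 then 1 else
    ((‖a‖ ^ 2 / ‖Kcross c‖ : ℝ) : ℂ) ^ (x - 1) *
      (((‖a‖ ^ 2 / ‖Kcross c‖ : ℝ) : ℂ) - conj (phaseRoot c))

/-- Writing `conj K = |K|² / K` separates a real constant from the phases of `K_×`. The minus sign
will cancel against that of `∑ j, (ψ j - ψ r) = -κ (ψ r - mean ψ)`. -/
theorem gammaCross_eq (ha : a ≠ 0) (hac : a * conj a + c * conj c = 1) {x t : ℕ} :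
    gammaCross a c x t = -(((‖c‖ ^ 2 * (‖c‖ ^ 2 - cosPhase c ^ 2) / (Kminus c * Kplus c) : ℝ) : ℂ) *
      crossFactor a c x t) := by
  have hk := Kcross_ne_zero ha hac
  have hm : (‖Kcross c‖ : ℂ) ≠ 0 := by exact_mod_cast norm_ne_zero_iff.2 hk
  have hk' : conj (Kcross c) ≠ 0 := (map_ne_zero _).2 hk
  have hKK : Kminus c * Kplus c = ‖Kcross c‖ ^ 2 := by
    rw [norm_Kcross, Kplus, Kminus, mul_pow]
  have hconj : conj (Kcross c) = ‖Kcross c‖ ^ 2 / Kcross c := by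
    rw [← Complex.mul_conj', mul_div_cancel_left₀ _ hk]
  rw [gammaCross, crossFactor, sqrt_Kplus_mul_Kminus, hKK, phaseRoot_eq ha hac, map_div₀,
    Complex.conj_ofReal, hconj, pow_succ]
  generalize (Kcross c / (‖Kcross c‖ : ℂ)) ^ t = P
  generalize Kcross c = k at *
  cases x with
  | zero =>
    simp only [if_true]
    push_cast
    field_simp
  | succ n =>
    simp only [Nat.succ_ne_zero, if_false, Nat.add_sub_cancel]
    push_cast
    generalize ((‖a‖ : ℂ) ^ 2 / (‖k‖ : ℂ)) ^ n = R
    field_simp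
    ring

theorem norm_sq_add (z w : ℂ) : ‖z + w‖ ^ 2 = ‖z‖ ^ 2 + ‖w‖ ^ 2 + 2 * (conj z * w).re := by
  rw [Complex.sq_norm, Complex.sq_norm, Complex.sq_norm, add_comm z w, Complex.normSq_add,
    mul_comm (conj z)]
  ring

/-- The squared moduli of the components of a stationary solution at distance `x`. -/
noncomputable def decayProfile (Q : ℝ) (x : ℕ) : ℝ := if x = 0 then 1 else Q ^ (x - 1) * (1 + Q)

/-- In terms of the mean and the deviation the powers of `κ` cancel against `b_κ`, and since
indicators are idempotent they can be absorbed into the squares and the product of the limiting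
amplitudes. -/
theorem envelope_eq {κ : ℕ} (hκ : 1 ≤ κ) (ha : a ≠ 0) (hc : c ≠ 0)
    (hac : a * conj a + c * conj c = 1) (ψ : Fin κ → ℂ) (r : Fin κ) (x t : ℕ) :
    envelope a c ψ r x t =
      ‖mean ψ‖ ^ 2 * limitAmp a c 1 ^ 2 * decayProfile (‖a‖ ^ 2 / Kminus c) x +
      ‖ψ r - mean ψ‖ ^ 2 * limitAmp a c (-1) ^ 2 * decayProfile (‖a‖ ^ 2 / Kplus c) x +
      2 * (conj (mean ψ) * (ψ r - mean ψ) *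
        (((limitAmp a c 1 * limitAmp a c (-1) : ℝ) : ℂ) * crossFactor a c x t)).re := by
  have hκ0 : (κ : ℂ) ≠ 0 := by exact_mod_cast (by omega : κ ≠ 0)
  have hκ1 : (κ : ℝ) ≠ 0 := by exact_mod_cast (by omega : κ ≠ 0)
  have hs : ∑ j, ψ j = κ * mean ψ := by rw [mean]; field_simp
  have hs' : ∑ j, conj (ψ j) = κ * conj (mean ψ) := by
    rw [← map_sum, hs, map_mul, Complex.conj_natCast]
  have hd : ∑ j, (ψ j - ψ r) = -(κ * (ψ r - mean ψ)) := by
    rw [Finset.sum_sub_distrib, hs]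
    simp; ring
  have hm := Kminus_pos ha hac
  have hp := Kplus_pos ha hac
  have hi := indicator_mul_self (Set.Ico (-1) ‖c‖) (cosPhase c)
  have hj := indicator_mul_self (Set.Ioc (-‖c‖) 1) (cosPhase c)
  have hLc : Lc a c ψ r x t = 2 * (4 * (‖c‖ ^ 2 * (‖c‖ ^ 2 - cosPhase c ^ 2) /
      (Kminus c * Kplus c))) * (conj (mean ψ) * (ψ r - mean ψ) * crossFactor a c x t).re := by
    rw [Lc, gammaCross_eq ha hac, hs', hd, bCoef]
    generalize ‖c‖ ^ 2 * (‖c‖ ^ 2 - cosPhase c ^ 2) / (Kminus c * Kplus c) = X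
    have : -((X : ℂ) * crossFactor a c x t) * (κ * conj (mean ψ)) * -(κ * (ψ r - mean ψ)) =
        ((κ ^ 2 * X : ℝ) : ℂ) * (conj (mean ψ) * (ψ r - mean ψ) * crossFactor a c x t) := by
      push_cast; ring
    rw [this, Complex.re_ofReal_mul]
    field_simp
    ring
  rw [envelope, hLc, indicator_mul_indicator, Lm, Lp, gammaMinus, gammaPlus, ← decayProfile,
    ← decayProfile, hs, hd, limitAmp_one ha hc hac, limitAmp_neg_one ha hc hac, norm_neg, norm_mul,
    norm_mul, Complex.norm_natCast, bCoef]
  generalize (Set.Ico (-1) ‖c‖).indicator (fun _ => (1 : ℝ)) (cosPhase c) = i at *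
  generalize (Set.Ioc (-‖c‖) 1).indicator (fun _ => (1 : ℝ)) (cosPhase c) = j at *
  rw [mul_left_comm _ (Complex.ofReal _), Complex.re_ofReal_mul]
  have e1 : i * ((2 / (κ : ℝ)) ^ 2 * ‖c‖ ^ 2 * (cosPhase c - ‖c‖) ^ 2 / Kminus c ^ 2 *
      decayProfile (‖a‖ ^ 2 / Kminus c) x * (κ * ‖mean ψ‖) ^ 2) =
      ‖mean ψ‖ ^ 2 * (i * (2 * ‖c‖ * (‖c‖ - cosPhase c) / Kminus c)) ^ 2 *
        decayProfile (‖a‖ ^ 2 / Kminus c) x := by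
    rw [mul_pow i, pow_two i, hi]
    field_simp
    ring
  have e2 : j * ((2 / (κ : ℝ)) ^ 2 * ‖c‖ ^ 2 * (cosPhase c + ‖c‖) ^ 2 / Kplus c ^ 2 *
      decayProfile (‖a‖ ^ 2 / Kplus c) x * (κ * ‖ψ r - mean ψ‖) ^ 2) =
      ‖ψ r - mean ψ‖ ^ 2 * (j * (2 * ‖c‖ * (‖c‖ + cosPhase c) / Kplus c)) ^ 2 *
        decayProfile (‖a‖ ^ 2 / Kplus c) x := by
    rw [mul_pow j, pow_two j, hj]
    field_simp
    ring
  rw [e1, e2]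
  congr 1
  field_simp
  ring

/-- The amplitude of the stationary solution, with the parity factor removed. -/
theorem norm_sq_stationary (ha : a ≠ 0) (hac : a * conj a + c * conj c = 1)
    (hδ : δ * conj δ = 1) (S D : ℂ) (A B : ℝ) (n t : ℕ) :
    ‖S * (A * decayRatio a c δ 1 ^ n * eigenPhase c δ 1 ^ t) +
        D * (B * decayRatio a c δ (-1) ^ n * eigenPhase c δ (-1) ^ t)‖ ^ 2 =
      ‖S‖ ^ 2 * A ^ 2 * (‖a‖ ^ 2 / Kminus c) ^ n + ‖D‖ ^ 2 * B ^ 2 * (‖a‖ ^ 2 / Kplus c) ^ n +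
      2 * (conj S * D * (((A * B : ℝ) : ℂ) * (phaseRoot c ^ t *
        ((‖a‖ ^ 2 / ‖Kcross c‖ : ℝ) : ℂ) ^ n))).re := by
  have hp := one_sub_sign_mul_ne_zero ha hac (Or.inl rfl)
  have hm := one_sub_sign_mul_ne_zero ha hac (Or.inr rfl)
  have h1 := norm_decayRatio_sq (a := a) (c := c) (e := 1) hδ
  have h2 := norm_decayRatio_sq (a := a) (c := c) (e := -1) hδ
  rw [one_mul, ← Kminus] at h1
  rw [neg_one_mul, sub_neg_eq_add, ← Kplus] at h2
  rw [norm_sq_add, ← h1, ← h2, ← conj_eigenPhase_mul ha hac hδ, ← conj_decayRatio_mul hδ]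
  congr 1
  · simp only [norm_mul, norm_pow, norm_eigenPhase hp hδ (Or.inl rfl),
      norm_eigenPhase hm hδ (Or.inr rfl), one_pow, mul_one, mul_pow, Complex.norm_real,
      Real.norm_eq_abs, sq_abs]
    ring
  · congr 2
    simp only [map_mul, map_pow, Complex.conj_ofReal, Complex.ofReal_mul]
    ring

end Constants

theorem tendsto_norm_sq_sub {f g : ℕ → ℂ} {B : ℝ} (hB : ∀ t, ‖g t‖ ≤ B)
    (h : Tendsto (fun t => f t - g t) atTop (𝓝 0)) :
    Tendsto (fun t => ‖f t‖ ^ 2 - ‖g t‖ ^ 2) atTop (𝓝 0) := by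
  have h1 : Tendsto (fun t => ‖f t - g t‖ * (‖f t - g t‖ + 2 * B)) atTop (𝓝 0) := by
    have := h.norm
    rw [norm_zero] at this
    simpa using this.mul (this.add_const (2 * B))
  refine squeeze_zero_norm (fun t => ?_) h1
  have h2 := abs_norm_sub_norm_le (f t) (g t)
  rw [Real.norm_eq_abs, sq_sub_sq, abs_mul, mul_comm]
  refine mul_le_mul h2 ?_ (abs_nonneg _) (norm_nonneg _)
  rw [abs_of_nonneg (by positivity)]
  have h3 := le_abs_self (‖f t‖ - ‖g t‖)
  linarith [hB t]

/-! ### Comparison of the probabilities with the asymptotic expression. -/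

section Stationary

variable {a c δ : ℂ}

/-- The limiting amplitude of `Up` at distance `n`, and of the origin for `n = 0`. -/
noncomputable def stationaryUp (a c δ S D : ℂ) (t n : ℕ) : ℂ :=
  evenInd (t + n) * (S * (limitAmp a c 1 * decayRatio a c δ 1 ^ n * eigenPhase c δ 1 ^ t) +
    D * (limitAmp a c (-1) * decayRatio a c δ (-1) ^ n * eigenPhase c δ (-1) ^ t))

theorem norm_stationaryUp_le (hp : ‖eigenPhase c δ 1‖ = 1) (hm : ‖eigenPhase c δ (-1)‖ = 1)
    (S D : ℂ) (t n : ℕ) : ‖stationaryUp a c δ S D t n‖ ≤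
      ‖S‖ * ‖limitAmp a c 1 * decayRatio a c δ 1 ^ n‖ +
        ‖D‖ * ‖limitAmp a c (-1) * decayRatio a c δ (-1) ^ n‖ := by
  rw [stationaryUp, norm_mul]
  refine (mul_le_of_le_one_left (norm_nonneg _) (norm_evenInd_le _)).trans
    ((norm_add_le _ _).trans (le_of_eq ?_))
  simp only [norm_mul, norm_pow, hp, hm, one_pow, mul_one]

theorem asymptotic_of_odd {κ : ℕ} (ψ : Fin κ → ℂ) (r : Fin κ) {x t : ℕ} (h : Odd (t + x)) :
    asymptotic a c ψ r x t = 0 := by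
  rw [asymptotic, h.neg_one_pow]; norm_num

theorem asymptotic_of_even {κ : ℕ} (ψ : Fin κ → ℂ) (r : Fin κ) {x t : ℕ} (h : Even (t + x)) :
    asymptotic a c ψ r x t = envelope a c ψ r x t := by
  rw [asymptotic, h.neg_one_pow]; norm_num

theorem asymptotic_zero_eq {κ : ℕ} (hκ : 1 ≤ κ) (ha : a ≠ 0) (hc : c ≠ 0)
    (hac : a * conj a + c * conj c = 1) (hδ : δ * conj δ = 1) (ψ : Fin κ → ℂ) (r : Fin κ) (t : ℕ) :
    asymptotic a c ψ r 0 t = ‖stationaryUp a c δ (mean ψ) (ψ r - mean ψ) t 0‖ ^ 2 := by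
  rcases Nat.even_or_odd (t + 0) with h | h
  · rw [asymptotic_of_even ψ r h, stationaryUp, evenInd, if_pos h, one_mul,
      norm_sq_stationary ha hac hδ, envelope_eq hκ ha hc hac]
    simp [decayProfile, crossFactor]
  · rw [asymptotic_of_odd ψ r h, stationaryUp, evenInd, if_neg (Nat.not_even_iff_odd.2 h)]
    simp

/-- At a vertex other than the origin `Up` carries exponent `n + 1` and `Down` exponent `n`, whence
the factor `1 + Q` in the direct terms. In the interference term the `Down` components bring `e *
conj μ` for `e = 1` and `e = -1`, whose mutual phase is `-conj (phaseRoot c)`. -/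
theorem asymptotic_succ_eq {κ : ℕ} (hκ : 1 ≤ κ) (ha : a ≠ 0) (hc : c ≠ 0)
    (hac : a * conj a + c * conj c = 1) (hδ : δ * conj δ = 1) (ψ : Fin κ → ℂ) (r : Fin κ)
    (n t : ℕ) :
    asymptotic a c ψ r (n + 1) t =
      ‖stationaryUp a c δ (mean ψ) (ψ r - mean ψ) t (n + 1)‖ ^ 2 +
      ‖evenInd (t + n + 1) * (mean ψ * conj (eigenPhase c δ 1) *
        (limitAmp a c 1 * decayRatio a c δ 1 ^ n * eigenPhase c δ 1 ^ t) +
        -(ψ r - mean ψ) * conj (eigenPhase c δ (-1)) *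
        (limitAmp a c (-1) * decayRatio a c δ (-1) ^ n * eigenPhase c δ (-1) ^ t))‖ ^ 2 := by
  have hp := norm_eigenPhase (one_sub_sign_mul_ne_zero ha hac (Or.inl rfl)) hδ (Or.inl rfl)
  have hm := norm_eigenPhase (one_sub_sign_mul_ne_zero ha hac (Or.inr rfl)) hδ (Or.inr rfl)
  rcases Nat.even_or_odd (t + n + 1) with h | h
  · rw [asymptotic_of_even ψ r (x := n + 1) h, stationaryUp, evenInd, evenInd,
      if_pos (show Even (t + (n + 1)) from h), if_pos h, one_mul, one_mul,
      norm_sq_stationary ha hac hδ, norm_sq_stationary ha hac hδ, envelope_eq hκ ha hc hac]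
    simp only [norm_mul, norm_neg, Complex.norm_conj, hp, hm, mul_one, decayProfile, crossFactor,
      Nat.succ_ne_zero, if_false, Nat.add_sub_cancel]
    have h1 : conj (mean ψ * conj (eigenPhase c δ 1)) *
        (-(ψ r - mean ψ) * conj (eigenPhase c δ (-1))) =
        -(conj (mean ψ) * (ψ r - mean ψ) * conj (phaseRoot c)) := by
      rw [← conj_eigenPhase_mul ha hac hδ]
      simp only [map_mul, Complex.conj_conj]
      ring
    rw [h1]
    generalize conj (mean ψ) * (ψ r - mean ψ) = z
    generalize ((limitAmp a c 1 * limitAmp a c (-1) : ℝ) : ℂ) = w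
    generalize ((‖a‖ ^ 2 / ‖Kcross c‖ : ℝ) : ℂ) = R
    have h2 : z * (w * (phaseRoot c ^ t * (R ^ n * (R - conj (phaseRoot c))))) =
        z * (w * (phaseRoot c ^ t * R ^ (n + 1))) +
        -(z * conj (phaseRoot c)) * (w * (phaseRoot c ^ t * R ^ n)) := by ring
    rw [h2, Complex.add_re]
    ring
  · rw [asymptotic_of_odd ψ r (x := n + 1) h, stationaryUp, evenInd, evenInd,
      if_neg (Nat.not_even_iff_odd.2 h),
      if_neg (show ¬Even (t + (n + 1)) from Nat.not_even_iff_odd.2 h)]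
    simp

theorem prob_succ_eq {κ : ℕ} (C : Matrix (Fin 2) (Fin 2) ℂ) (ψ : Fin κ → ℂ) (r : Fin κ)
    (t n : ℕ) : prob C ψ r t (n + 1) =
      ‖stateAt C ψ t (.arm r n 0)‖ ^ 2 + ‖stateAt C ψ t (.arm r n 1)‖ ^ 2 := by
  rw [prob, Fin.sum_univ_two]

theorem tendsto_prob_sub_asymptotic {κ : ℕ} (hκ : 1 ≤ κ) (ha : a ≠ 0) (hc : c ≠ 0)
    (hac : a * conj a + c * conj c = 1) (hδ : δ * conj δ = 1) (ψ : Fin κ → ℂ) (r : Fin κ) (x : ℕ) :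
    (∀ t, Odd (t + x) →
      prob !![a, -(δ ^ 2 * conj c); c, δ ^ 2 * conj a] ψ r t x = 0) ∧
    Tendsto (fun t => prob !![a, -(δ ^ 2 * conj c); c, δ ^ 2 * conj a] ψ r t x -
      asymptotic a c ψ r x t) atTop (𝓝 0) := by
  obtain ⟨U, V, h, hU, hV, -⟩ := exists_isWalk ha hc hac hδ (e := 1) (Or.inl rfl)
  obtain ⟨U', V', h', hU', hV', -⟩ := exists_isWalk ha hc hac hδ (e := -1) (Or.inr rfl)
  have hstate := fun t => stateAt_eq hκ h hU hV h' hU' hV' ψ t r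
  have hinit : ∀ n, Odd n → (fun n => if n = 0 then (1 : ℂ) else 0) n = 0 := by
    intro n hn
    exact if_neg (by rintro rfl; simp at hn)
  have hpar := h.parity (fun n hn => by rw [hU]; exact hinit n hn) (fun n => by rw [hV]; rfl)
  have hpar' := h'.parity (fun n hn => by rw [hU']; exact hinit n hn) (fun n => by rw [hV']; rfl)
  have hlim := tendsto_sub_stationary ha hc hac hδ (Or.inl rfl) h hU hV
  have hlim' := tendsto_sub_stationary ha hc hac hδ (Or.inr rfl) h' hU' hV'
  have hp := norm_eigenPhase (one_sub_sign_mul_ne_zero ha hac (Or.inl rfl)) hδ (Or.inl rfl)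
  have hm := norm_eigenPhase (one_sub_sign_mul_ne_zero ha hac (Or.inr rfl)) hδ (Or.inr rfl)
  have hlimU : ∀ n, Tendsto (fun t => mean ψ * U t n + (ψ r - mean ψ) * U' t n -
      stationaryUp a c δ (mean ψ) (ψ r - mean ψ) t n) atTop (𝓝 0) := by
    intro n
    have := ((hlim n).1.const_mul (mean ψ)).add ((hlim' n).1.const_mul (ψ r - mean ψ))
    rw [mul_zero, mul_zero, add_zero] at this
    refine this.congr fun t => ?_
    rw [stationaryUp]; ring
  have hlimV : ∀ n, Tendsto (fun t => mean ψ * V t n + (ψ r - mean ψ) * V' t n -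
      evenInd (t + n + 1) * (mean ψ * conj (eigenPhase c δ 1) *
        (limitAmp a c 1 * decayRatio a c δ 1 ^ n * eigenPhase c δ 1 ^ t) +
        -(ψ r - mean ψ) * conj (eigenPhase c δ (-1)) *
        (limitAmp a c (-1) * decayRatio a c δ (-1) ^ n * eigenPhase c δ (-1) ^ t))) atTop
        (𝓝 0) := by
    intro n
    have := ((hlim n).2.const_mul (mean ψ)).add ((hlim' n).2.const_mul (ψ r - mean ψ))
    rw [mul_zero, mul_zero, add_zero] at this
    refine this.congr fun t => ?_
    ring
  cases x with
  | zero =>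
    refine ⟨fun t ht => ?_, ?_⟩
    · rw [prob, (hstate t).1, (hpar t 0).1 ht, (hpar' t 0).1 ht]
      simp
    · refine (tendsto_norm_sq_sub (norm_stationaryUp_le hp hm _ _ · 0) (hlimU 0)).congr fun t => ?_
      rw [prob, (hstate t).1, asymptotic_zero_eq hκ ha hc hac hδ]
  | succ n =>
    refine ⟨fun t ht => ?_, ?_⟩
    · have ht' : Even (t + n) := by rw [Nat.odd_iff] at ht; rw [Nat.even_iff]; omega
      rw [prob_succ_eq, ((hstate t).2 n).1, ((hstate t).2 n).2, (hpar t (n + 1)).1 ht,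
        (hpar' t (n + 1)).1 ht, (hpar t n).2 ht', (hpar' t n).2 ht']
      simp
    · have hbV : ∀ t, ‖evenInd (t + n + 1) * (mean ψ * conj (eigenPhase c δ 1) *
          (limitAmp a c 1 * decayRatio a c δ 1 ^ n * eigenPhase c δ 1 ^ t) +
          -(ψ r - mean ψ) * conj (eigenPhase c δ (-1)) *
          (limitAmp a c (-1) * decayRatio a c δ (-1) ^ n * eigenPhase c δ (-1) ^ t))‖ ≤
          ‖mean ψ‖ * ‖limitAmp a c 1 * decayRatio a c δ 1 ^ n‖ +
            ‖ψ r - mean ψ‖ * ‖limitAmp a c (-1) * decayRatio a c δ (-1) ^ n‖ := by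
        intro t
        rw [norm_mul]
        refine (mul_le_of_le_one_left (norm_nonneg _) (norm_evenInd_le _)).trans
          ((norm_add_le _ _).trans (le_of_eq ?_))
        simp only [norm_mul, norm_pow, norm_neg, Complex.norm_conj, hp, hm, one_pow, mul_one]
      have h1 := tendsto_norm_sq_sub (norm_stationaryUp_le hp hm _ _ · (n + 1)) (hlimU (n + 1))
      have h2 := tendsto_norm_sq_sub hbV (hlimV n)
      have h3 := h1.add h2
      rw [add_zero] at h3
      refine h3.congr fun t => ?_
      rw [prob_succ_eq, ((hstate t).2 n).1, ((hstate t).2 n).2,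
        asymptotic_succ_eq hκ ha hc hac hδ]
      ring

end Stationary

/-! ### Exponential decay in the distance. -/

section Decay

variable {a c : ℂ} {κ : ℕ}

theorem exists_forall_decay_le {Q : ℝ} (hQ : 0 < Q) {B : ℝ} (hB : 0 ≤ B) :
    ∃ M : ℝ, 0 ≤ M ∧ ∀ x : ℕ, (if x = 0 then 1 else Q ^ (x - 1) * B) ≤ M * Q ^ x := by
  -- The `1` covers the origin, and `B / Q` compensates the exponent `x - 1` elsewhere.
  refine ⟨1 + B / Q, by positivity, fun x => ?_⟩
  cases x with
  | zero =>
    simp only [if_true, pow_zero, mul_one, le_add_iff_nonneg_right]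
    positivity
  | succ n =>
    simp only [Nat.succ_ne_zero, if_false, Nat.add_sub_cancel]
    have h1 : (1 + B / Q) * Q ^ (n + 1) = Q ^ (n + 1) + Q ^ n * B := by
      rw [pow_succ]; field_simp
    rw [h1]
    exact le_add_of_nonneg_left (by positivity)

theorem exists_Lm_le (ha : a ≠ 0) (hK : 0 < Kminus c) (ψ : Fin κ → ℂ) :
    ∃ M : ℝ, ∀ x : ℕ, |Lm a c ψ x| ≤ M * (‖a‖ ^ 2 / Kminus c) ^ x := by
  have ha' := norm_pos_iff.2 ha
  have hQ : 0 < ‖a‖ ^ 2 / Kminus c := by positivity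
  obtain ⟨M, -, hM⟩ := exists_forall_decay_le hQ (B := 1 + ‖a‖ ^ 2 / Kminus c) (by positivity)
  refine ⟨bCoef κ ^ 2 * ‖c‖ ^ 2 * (cosPhase c - ‖c‖) ^ 2 / Kminus c ^ 2 * ‖∑ j, ψ j‖ ^ 2 * M,
    fun x => ?_⟩
  have h0 : 0 ≤ (if x = 0 then 1 else (‖a‖ ^ 2 / Kminus c) ^ (x - 1) *
      (1 + ‖a‖ ^ 2 / Kminus c)) := by split_ifs <;> positivity
  rw [Lm, gammaMinus, abs_of_nonneg (by positivity), mul_right_comm, mul_assoc _ M]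
  exact mul_le_mul_of_nonneg_left (hM x) (by positivity)

theorem exists_Lp_le (ha : a ≠ 0) (hK : 0 < Kplus c) (ψ : Fin κ → ℂ) (r : Fin κ) :
    ∃ M : ℝ, ∀ x : ℕ, |Lp a c ψ r x| ≤ M * (‖a‖ ^ 2 / Kplus c) ^ x := by
  have ha' := norm_pos_iff.2 ha
  have hQ : 0 < ‖a‖ ^ 2 / Kplus c := by positivity
  obtain ⟨M, -, hM⟩ := exists_forall_decay_le hQ (B := 1 + ‖a‖ ^ 2 / Kplus c) (by positivity)
  refine ⟨bCoef κ ^ 2 * ‖c‖ ^ 2 * (cosPhase c + ‖c‖) ^ 2 / Kplus c ^ 2 *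
    ‖∑ j, (ψ j - ψ r)‖ ^ 2 * M, fun x => ?_⟩
  have h0 : 0 ≤ (if x = 0 then 1 else (‖a‖ ^ 2 / Kplus c) ^ (x - 1) *
      (1 + ‖a‖ ^ 2 / Kplus c)) := by split_ifs <;> positivity
  rw [Lp, gammaPlus, abs_of_nonneg (by positivity), mul_right_comm, mul_assoc _ M]
  exact mul_le_mul_of_nonneg_left (hM x) (by positivity)

theorem norm_phaseRoot (ha : a ≠ 0) (hac : a * conj a + c * conj c = 1) : ‖phaseRoot c‖ = 1 := by
  rw [phaseRoot_eq ha hac, norm_div, Complex.norm_real, norm_norm,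
    div_self (norm_ne_zero_iff.2 (Kcross_ne_zero ha hac))]

/-- Time enters only through a power of the unimodular `phaseRoot c`, so the bound is uniform in
`t`. -/
theorem exists_Lc_le (ha : a ≠ 0) (hac : a * conj a + c * conj c = 1) (ψ : Fin κ → ℂ)
    (r : Fin κ) : ∃ M : ℝ, ∀ x t : ℕ,
      |Lc a c ψ r x t| ≤ M * (‖a‖ ^ 2 / √(Kplus c * Kminus c)) ^ x := by
  have ha' := norm_pos_iff.2 ha
  have hK := norm_pos_iff.2 (Kcross_ne_zero ha hac)
  rw [sqrt_Kplus_mul_Kminus]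
  have hQ : 0 < ‖a‖ ^ 2 / ‖Kcross c‖ := by positivity
  obtain ⟨M, hM0, hM⟩ := exists_forall_decay_le hQ
    (B := ‖((‖a‖ ^ 2 / ‖Kcross c‖ : ℝ) : ℂ) - conj (phaseRoot c)‖) (norm_nonneg _)
  have hcross : ∀ x t, ‖crossFactor a c x t‖ ≤ M * (‖a‖ ^ 2 / ‖Kcross c‖) ^ x := by
    intro x t
    refine le_trans (le_of_eq ?_) (hM x)
    rw [crossFactor, norm_mul, norm_pow, norm_phaseRoot ha hac, one_pow, one_mul]
    split_ifs
    · simp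
    · rw [norm_mul, norm_pow, Complex.norm_real, Real.norm_of_nonneg hQ.le]
  set X := ((‖c‖ ^ 2 * (‖c‖ ^ 2 - cosPhase c ^ 2) / (Kminus c * Kplus c) : ℝ) : ℂ) with hX
  refine ⟨2 * bCoef κ ^ 2 * (‖X‖ * ‖∑ j, conj (ψ j)‖ * ‖∑ j, (ψ j - ψ r)‖) * M, fun x t => ?_⟩
  have h1 : ‖gammaCross a c x t * (∑ j, conj (ψ j)) * ∑ j, (ψ j - ψ r)‖ ≤
      ‖X‖ * ‖∑ j, conj (ψ j)‖ * ‖∑ j, (ψ j - ψ r)‖ * (M * (‖a‖ ^ 2 / ‖Kcross c‖) ^ x) := by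
    rw [gammaCross_eq ha hac, ← hX, norm_mul, norm_mul, norm_neg, norm_mul]
    calc ‖X‖ * ‖crossFactor a c x t‖ * ‖∑ j, conj (ψ j)‖ * ‖∑ j, (ψ j - ψ r)‖
        = ‖X‖ * ‖∑ j, conj (ψ j)‖ * ‖∑ j, (ψ j - ψ r)‖ * ‖crossFactor a c x t‖ := by ring
      _ ≤ _ := mul_le_mul_of_nonneg_left (hcross x t) (by positivity)
  have h2 : 0 ≤ 2 * bCoef κ ^ 2 := by positivity
  rw [Lc, abs_mul, abs_of_nonneg h2]
  refine (mul_le_mul_of_nonneg_left ((Complex.abs_re_le_norm _).trans h1) h2).trans (le_of_eq ?_)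
  ring

theorem div_sqrt_lt_one (hm : 0 < Kminus c) (hp : 0 < Kplus c)
    (h1 : ‖a‖ ^ 2 / Kminus c < 1) (h2 : ‖a‖ ^ 2 / Kplus c < 1) :
    ‖a‖ ^ 2 / √(Kplus c * Kminus c) < 1 := by
  rw [div_lt_one hm] at h1
  rw [div_lt_one hp] at h2
  rw [div_lt_one (Real.sqrt_pos.2 (by positivity)), Real.lt_sqrt (by positivity), pow_two]
  exact mul_lt_mul'' h2 h1 (by positivity) (by positivity)

end Decay

/-- On `s` the relative error is at most `|f - g| / ε`. The restriction to `s` is needed because the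
asymptotic expression vanishes at times of the wrong parity. -/
theorem tendsto_div_of_tendsto_sub {f g : ℕ → ℝ} {s : Set ℕ} {ε : ℝ} (hε : 0 < ε)
    (hg : ∀ᶠ t in atTop, t ∈ s → ε ≤ g t) (h : Tendsto (fun t => f t - g t) atTop (𝓝 0)) :
    Tendsto (fun t => f t / g t) (atTop ⊓ 𝓟 s) (𝓝 1) := by
  have hg' : ∀ᶠ t in atTop ⊓ 𝓟 s, ε ≤ g t := eventually_inf_principal.2 hg
  have h1 : Tendsto (fun t => |f t - g t| / ε) (atTop ⊓ 𝓟 s) (𝓝 0) := by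
    have := (h.mono_left (inf_le_left (b := 𝓟 s))).abs.div_const ε
    simpa using this
  have h2 : Tendsto (fun t => (f t - g t) / g t) (atTop ⊓ 𝓟 s) (𝓝 0) := by
    refine squeeze_zero_norm' ?_ h1
    filter_upwards [hg'] with t ht
    rw [Real.norm_eq_abs, abs_div, abs_of_pos (hε.trans_le ht)]
    exact div_le_div_of_nonneg_left (abs_nonneg _) hε ht
  have h3 := h2.const_add 1
  rw [add_zero] at h3
  refine h3.congr' ?_
  filter_upwards [hg'] with t ht
  have : g t ≠ 0 := (hε.trans_le ht).ne'
  field_simp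
  ring

end JoinedHalfLines

theorem theorem1 (κ : ℕ) (hκ : 1 ≤ κ) (a b c d : ℂ)
    (hC : !![a, b; c, d] ∈ Matrix.unitaryGroup (Fin 2) ℂ) (habcd : a * b * c * d ≠ 0)
    (ψ : Fin κ → ℂ) (hψ : ∑ j, ‖ψ j‖ ^ 2 = 1) (r : Fin κ) :
    (∀ x : ℕ,
      -- the walk respects the parity factor exactly
      (∀ t : ℕ, Odd (t + x) → prob !![a, b; c, d] ψ r t x = 0) ∧
      -- the difference of the two sides tends to zero
      Tendsto (fun t : ℕ => prob !![a, b; c, d] ψ r t x - asymptotic a c ψ r x t) atTop (𝓝 0) ∧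
      -- the quotient tends to one along `t + x` even, if the limit does not degenerate
      ((∃ ε : ℝ, 0 < ε ∧ ∀ᶠ t : ℕ in atTop, Even (t + x) → ε ≤ envelope a c ψ r x t) →
        Tendsto (fun t : ℕ => prob !![a, b; c, d] ψ r t x / asymptotic a c ψ r x t)
          (atTop ⊓ 𝓟 {t : ℕ | Even (t + x)}) (𝓝 1))) ∧
    -- each term decays exponentially in `x` when its indicator is on
    (cosPhase c < ‖c‖ → ‖a‖ ^ 2 / Kminus c < 1 ∧
      ∃ M : ℝ, ∀ x : ℕ, |Lm a c ψ x| ≤ M * (‖a‖ ^ 2 / Kminus c) ^ x) ∧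
    (-‖c‖ < cosPhase c → ‖a‖ ^ 2 / Kplus c < 1 ∧
      ∃ M : ℝ, ∀ x : ℕ, |Lp a c ψ r x| ≤ M * (‖a‖ ^ 2 / Kplus c) ^ x) ∧
    (-‖c‖ < cosPhase c → cosPhase c < ‖c‖ →
      ‖a‖ ^ 2 / Real.sqrt (Kplus c * Kminus c) < 1 ∧
      ∃ M : ℝ, ∀ x t : ℕ,
        |Lc a c ψ r x t| ≤ M * (‖a‖ ^ 2 / Real.sqrt (Kplus c * Kminus c)) ^ x) := by
  obtain ⟨δ, hδ, hac, rfl, rfl⟩ := exists_unitary_parameter hC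
  have hc : c ≠ 0 := fun h => habcd (by simp [h])
  have ha : a ≠ 0 := fun h => habcd (by simp [h])
  have hm := Kminus_pos ha hac
  have hp := Kplus_pos ha hac
  refine ⟨fun x => ?_, fun h => ⟨(div_Kminus_lt_one_iff ha hc hac).2 h, exists_Lm_le ha hm ψ⟩,
    fun h => ⟨(div_Kplus_lt_one_iff ha hc hac).2 h, exists_Lp_le ha hp ψ r⟩,
    fun h h' => ⟨div_sqrt_lt_one hm hp ((div_Kminus_lt_one_iff ha hc hac).2 h')
      ((div_Kplus_lt_one_iff ha hc hac).2 h), exists_Lc_le ha hac ψ r⟩⟩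
  obtain ⟨hodd, hlim⟩ := tendsto_prob_sub_asymptotic hκ ha hc hac hδ ψ r x
  refine ⟨hodd, hlim, ?_⟩
  rintro ⟨ε, hε, h⟩
  refine tendsto_div_of_tendsto_sub hε ?_ hlim
  filter_upwards [h] with t ht het
  rw [asymptotic_of_even ψ r het]
  exact ht het
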